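/- Let $X$ and $A$ be finite sets, $A\neq\emptyset$, and let $\mathcal P(X)$ be the simplex of beliefs over $X$. Let $u:A\times X\to\mathbb R$, $\hat u(q)=\max_{a\in A}\sum_x q_x u_{a,x}$, let $\bar\kappa,\chi,\rho>0$, and let $H:\mathcal P(X)\to\mathbb R_+$ be continuous, strongly convex, and twice continuously differentiable on the relative interior of $\mathcal P(X)$. Let $\Omega$ be the set of càdlàg paths $\mathbb R_+\to\mathcal P(X)$, $q$ the canonical process, and $(\mathcal F_t)$ its natural filtration. Given $\bar q_0\in\mathcal P(X)$, a *policy* is a triple $(P,I,\tau)$ where $P$ is a probability measure on $\Omega$ under which $q$ is an $(\mathcal F_t)$-martingale with $q_0=\bar q_0$ a.s., $\tau$ is an a.s. finite $(\mathcal F_t)$-stopping time, and $I$ is an increasing adapted process with $I_0=0$ which up to time $\tau$ is the cumulative information, accumulated at a rate of at most $\chi$: for all $s\le t$, $$\mathbb E^P[H(q_{t\wedge\tau})-H(q_{s\wedge\tau})\mid\mathcal F_s]=\mathbb E^P[I_{t\wedge\tau}-I_{s\wedge\tau}\mid\mathcal F_s]\ \text{ a.s.},$$ and almost surely $I_t-I_s\le\chi(t-s)$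 for all $s\le t\le\tau$. The policy is *feasible* if $\tau$ maximizes $\mathbb E^P[\hat u(q_{\tau'})-\bar\kappa\tau']$ over all a.s. finite $(\mathcal F_t)$-stopping times $\tau'$, and *optimal* if it is feasible and maximizes $\rho\,\mathbb E^P[I_\tau]$ over all feasible policies. The *relaxed problem* is to maximize $\rho\,\mathbb E^\pi[H(q)-H(\bar q_0)]$ over the Borel probability measures $\pi$ on $\mathcal P(X)$ with $\mathbb E^\pi[q]=\bar q_0$ and $\frac{\bar\kappa}{\chi}\mathbb E^\pi[H(q)-H(\bar q_0)]\le\mathbb E^\pi[\hat u(q)-\hat u(\bar q_0)]$. For $\alpha>0$, the *$\alpha$-dilution* of $\pi$ is the process $\bar q_0+\mathbf 1_{\{N(t)\ge1\}}(Q-\bar q_0)$, where $Q\sim\pi$ and $N$ is an independent Poisson process of rate $\alpha$. **Theorem.** For every $\bar q_0\in\mathcal P(X)$ the relaxed problem has a solution $\pi^*$ with finite support. Moreover, for every such solution $\pi^*$: 1. If $\operatorname{Supp}(\pi^*)=\{\bar q_0\}$, then feasible policies exist, and every feasible policy $(P,I,\tau)$ satisfies $\tau=0$ $P$-a.s. (the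 agent stops at once) and is optimal. 2. Otherwise $\mathbb E^{\pi^*}[H(q)-H(\bar q_0)]>0$. Let $\alpha^*=\chi/\mathbb E^{\pi^*}[H(q)-H(\bar q_0)]$, and let $P^*$ be the law of the $\alpha^*$-dilution of $\pi^*$. Then there is an $(\mathcal F_t)$-stopping time $\tau^*$ that is $P^*$-a.s. equal to the first jump time $\inf\{t: q_t\ne q_0\}$, such that $(P^*,\,I^*_t=\chi t,\,\tau^*)$ is optimal. -/

import Mathlib

open MeasureTheory ProbabilityTheory Filter Topology
open scoped NNReal ENNReal

namespace Engagement

/-- Beliefs over the finite state space `X`: the probability simplex, with its usual topology and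
Borel sigma-algebra. -/
abbrev Belief (X : Type*) [Fintype X] : Type _ := stdSimplex ℝ X

/-- Right-continuous with left limits. (At `t = 0` the left-limit clause is empty.) -/
def IsCadlag {E : Type*} [TopologicalSpace E] (f : ℝ≥0 → E) : Prop :=
  ∀ t : ℝ≥0, ContinuousWithinAt f (Set.Ici t) t ∧ ∃ l : E, Tendsto f (𝓝[<] t) (𝓝 l)

/-- The space of belief-valued càdlàg paths; its sigma-algebra is the one generated by the
coordinate maps. -/
abbrev PathSpace (X : Type*) [Fintype X] : Type _ := {ω : ℝ≥0 → Belief X // IsCadlag ω}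

/-- The canonical process: `belief t ω` is the belief at time `t` along the path `ω`. -/
def belief {X : Type*} [Fintype X] (t : ℝ≥0) (ω : PathSpace X) : Belief X := ω.1 t

lemma measurable_belief {X : Type*} [Fintype X] (t : ℝ≥0) :
    Measurable (belief t : PathSpace X → Belief X) :=
  (measurable_pi_apply t).comp measurable_subtype_coe

/-- The natural filtration of the canonical process. -/
noncomputable def naturalFiltration (X : Type*) [Fintype X] :
    Filtration ℝ≥0 (inferInstance : MeasurableSpace (PathSpace X)) :=
  Filtration.natural (fun t : ℝ≥0 => (belief t : PathSpace X → Belief X))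
    (fun t => (measurable_belief t).stronglyMeasurable)

/-- The primitives of the model: the agent's utility `u a x`, her flow cost of delay `κ`, the bound
`χ` on the rate of information processing, the principal's profit `ρ` per unit of attention, and
the generalized entropy function `H`. Only the values of `H` on the simplex matter. `H` is
non-negative, continuous and strongly convex on the simplex; twice continuous differentiability is
required only in the relative interior, so that entropy functions such as the negative of Shannon
entropy (plus a constant) are included. -/
structure Environment (X A : Type*) [Fintype X] where
  u : A → X → ℝ
  κ : ℝ
  χ : ℝ
  ρ : ℝ
  H : (X → ℝ) → ℝ
  κ_pos : 0 < κ
  χ_pos : 0 < χ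
  ρ_pos : 0 < ρ
  H_nonneg : ∀ q ∈ stdSimplex ℝ X, 0 ≤ H q
  H_continuousOn : ContinuousOn H (stdSimplex ℝ X)
  H_contDiffOn : ContDiffOn ℝ 2 H {q | q ∈ stdSimplex ℝ X ∧ ∀ x, 0 < q x}
  H_strongConvexOn : ∃ m : ℝ, 0 < m ∧ StrongConvexOn (stdSimplex ℝ X) m H

section Model

variable {X A : Type*} [Fintype X] [Fintype A] [Nonempty A]

/-- The payoff of an optimal action under the belief `q`. -/
noncomputable def Environment.uhat (M : Environment X A) (q : Belief X) : ℝ :=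
  Finset.univ.sup' Finset.univ_nonempty (fun a : A => ∑ x, q x * M.u a x)

/-! ### The agent's problem -/

/-- Admissible stopping times under `P`: stopping times of the natural filtration that are finite
almost surely. -/
def IsAdmissibleTime (P : Measure (PathSpace X)) (τ : PathSpace X → WithTop ℝ≥0) : Prop :=
  IsStoppingTime (naturalFiltration X) τ ∧ ∀ᵐ ω ∂P, τ ω ≠ ⊤

/-- The agent's expected payoff `E[uhat(q_τ) - κ τ]`. It is extended-real-valued: it equals `-∞`
exactly when the expected delay is infinite. -/
noncomputable def Environment.agentPayoff (M : Environment X A) (P : Measure (PathSpace X))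
    (τ : PathSpace X → WithTop ℝ≥0) : EReal :=
  ((∫ ω, M.uhat (stoppedValue belief τ ω) ∂P : ℝ) : EReal)
    - ((ENNReal.ofReal M.κ * ∫⁻ ω, ((τ ω).untopA : ℝ≥0∞) ∂P : ℝ≥0∞) : EReal)

/-- `τ` is an optimal stopping time for an agent whose beliefs have law `P`. -/
def Environment.IsAgentOptimal (M : Environment X A) (P : Measure (PathSpace X))
    (τ : PathSpace X → WithTop ℝ≥0) : Prop :=
  IsAdmissibleTime P τ ∧
    ∀ τ' : PathSpace X → WithTop ℝ≥0, IsAdmissibleTime P τ' →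
      M.agentPayoff P τ' ≤ M.agentPayoff P τ

/-! ### The principal's problem -/

/-- The policies available to the principal at the prior `q₀`: a law `P` under which beliefs are a
martingale started at `q₀`, an increasing adapted process `I` with `I 0 = 0`, and a stopping time
`τ`, such that up to time `τ` the process `I` is the cumulative information of the belief
process and accumulates at a rate of at most `χ`. -/
structure Environment.IsPolicy (M : Environment X A) (q₀ : Belief X) (P : Measure (PathSpace X))
    (I : ℝ≥0 → PathSpace X → ℝ) (τ : PathSpace X → WithTop ℝ≥0) : Prop where
  isProbabilityMeasure : IsProbabilityMeasure P
  prior : ∀ᵐ ω ∂P, belief 0 ω = q₀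
  martingale : Martingale (fun t ω => (belief t ω : X → ℝ)) (naturalFiltration X) P
  adapted : Adapted (naturalFiltration X) I
  initial : ∀ᵐ ω ∂P, I 0 ω = 0
  increasing : ∀ᵐ ω ∂P, Monotone (fun t => I t ω)
  stopping : IsAdmissibleTime P τ
  /-- Until `τ`, `I` measures the expected increase of `H` along the belief process:
  `E[H(q_{t ∧ τ}) - H(q_{s ∧ τ}) | F_s] = E[I_{t ∧ τ} - I_{s ∧ τ} | F_s]` for `s ≤ t`. -/
  information : ∀ s t : ℝ≥0, s ≤ t →
    P[fun ω => M.H (stoppedProcess belief τ t ω : Belief X)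
          - M.H (stoppedProcess belief τ s ω : Belief X) | naturalFiltration X s]
      =ᵐ[P] P[fun ω => stoppedProcess I τ t ω - stoppedProcess I τ s ω | naturalFiltration X s]
  /-- Until `τ`, information accumulates at rate at most `χ`. -/
  capacity : ∀ᵐ ω ∂P, ∀ s t : ℝ≥0, s ≤ t → (t : WithTop ℝ≥0) ≤ τ ω →
    I t ω - I s ω ≤ M.χ * ((t : ℝ) - (s : ℝ))

/-- A policy is feasible if in addition the stopping time is optimal for the agent. -/
def Environment.IsFeasible (M : Environment X A) (q₀ : Belief X) (P : Measure (PathSpace X))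
    (I : ℝ≥0 → PathSpace X → ℝ) (τ : PathSpace X → WithTop ℝ≥0) : Prop :=
  M.IsPolicy q₀ P I τ ∧ M.IsAgentOptimal P τ

/-- The principal's objective, expected engagement `ρ E[I_τ]`. -/
noncomputable def Environment.engagement (M : Environment X A) (P : Measure (PathSpace X))
    (I : ℝ≥0 → PathSpace X → ℝ) (τ : PathSpace X → WithTop ℝ≥0) : ℝ≥0∞ :=
  ENNReal.ofReal M.ρ * ∫⁻ ω, ENNReal.ofReal (stoppedValue I τ ω) ∂P

/-- `(P, I, τ)` is an optimal solution of the principal's problem at the prior `q₀`. -/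
def Environment.IsOptimal (M : Environment X A) (q₀ : Belief X) (P : Measure (PathSpace X))
    (I : ℝ≥0 → PathSpace X → ℝ) (τ : PathSpace X → WithTop ℝ≥0) : Prop :=
  M.IsFeasible q₀ P I τ ∧
    ∀ (P' : Measure (PathSpace X)) (I' : ℝ≥0 → PathSpace X → ℝ)
      (τ' : PathSpace X → WithTop ℝ≥0),
      M.IsFeasible q₀ P' I' τ' → M.engagement P' I' τ' ≤ M.engagement P I τ

/-! ### The relaxed static problem -/

/-- The expected increase `E^π[H(q) - H(q₀)]`. -/
noncomputable def Environment.infoGain (M : Environment X A) (q₀ : Belief X)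
    (π : ProbabilityMeasure (Belief X)) : ℝ :=
  ∫ q, (M.H q - M.H q₀) ∂(π : Measure (Belief X))

/-- Feasible measures of the relaxed problem: the mean belief is `q₀`, and
`(κ / χ) E^π[H(q) - H(q₀)] ≤ E^π[uhat(q) - uhat(q₀)]`. -/
def Environment.IsRelaxedFeasible (M : Environment X A) (q₀ : Belief X)
    (π : ProbabilityMeasure (Belief X)) : Prop :=
  (∀ x, ∫ q, q x ∂(π : Measure (Belief X)) = q₀ x) ∧
    M.κ / M.χ * M.infoGain q₀ π ≤ ∫ q, (M.uhat q - M.uhat q₀) ∂(π : Measure (Belief X))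

/-- `π` maximizes `ρ E^π[H(q) - H(q₀)]` among the feasible measures of the relaxed problem. -/
def Environment.IsRelaxedSolution (M : Environment X A) (q₀ : Belief X)
    (π : ProbabilityMeasure (Belief X)) : Prop :=
  M.IsRelaxedFeasible q₀ π ∧
    ∀ π' : ProbabilityMeasure (Belief X), M.IsRelaxedFeasible q₀ π' →
      M.ρ * M.infoGain q₀ π' ≤ M.ρ * M.infoGain q₀ π

end Model

/-! ### Dilutions -/

/-- The counting process with interarrival times `e 0, e 1, …`: the number of arrivals up to
time `t`. It is a Poisson process of rate `α` when the `e i` are i.i.d. exponential of rate `α`. -/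
noncomputable def arrivalCount (e : ℕ → ℝ≥0) (t : ℝ≥0) : ℕ∞ :=
  {n : ℕ | ∑ i ∈ Finset.range (n + 1), e i ≤ t}.encard

lemma one_le_arrivalCount_iff (e : ℕ → ℝ≥0) (t : ℝ≥0) : 1 ≤ arrivalCount e t ↔ e 0 ≤ t := by
  unfold arrivalCount
  rw [Set.one_le_encard_iff_nonempty]
  constructor
  · rintro ⟨n, hn⟩
    exact (Finset.single_le_sum (f := e) (fun _ _ => zero_le) (by simp)).trans hn
  · intro h
    exact ⟨0, by simpa using h⟩

open scoped Classical in
/-- The belief `q₀ + 1_{N(t) ≥ 1} (Q - q₀)`, where `N` counts the arrivals. -/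
noncomputable def dilutionFun {X : Type*} [Fintype X] (q₀ Q : Belief X) (e : ℕ → ℝ≥0)
    (t : ℝ≥0) : Belief X :=
  if 1 ≤ arrivalCount e t then Q else q₀

lemma isCadlag_dilutionFun {X : Type*} [Fintype X] (q₀ Q : Belief X) (e : ℕ → ℝ≥0) :
    IsCadlag (dilutionFun q₀ Q e) := by
  have hpos : ∀ t, e 0 ≤ t → dilutionFun q₀ Q e t = Q := fun t h => by
    simp [dilutionFun, one_le_arrivalCount_iff, h]
  have hneg : ∀ t, t < e 0 → dilutionFun q₀ Q e t = q₀ := fun t h => by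
    simp [dilutionFun, one_le_arrivalCount_iff, not_le.mpr h]
  intro t
  constructor
  · rcases le_or_gt (e 0) t with h | h
    · refine (continuousWithinAt_const (b := Q)).congr (fun s hs => hpos s (h.trans hs)) (hpos t h)
    · refine ContinuousAt.continuousWithinAt ?_
      refine (continuousAt_const (y := q₀)).congr ?_
      filter_upwards [Iio_mem_nhds h] with s hs using (hneg s hs).symm
  · rcases lt_or_ge (e 0) t with h | h
    · refine ⟨Q, tendsto_const_nhds.congr' ?_⟩
      filter_upwards [mem_nhdsWithin_of_mem_nhds (Ioi_mem_nhds h)] with s hs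
        using (hpos s (le_of_lt hs)).symm
    · refine ⟨q₀, tendsto_const_nhds.congr' ?_⟩
      filter_upwards [self_mem_nhdsWithin] with s hs using (hneg s (lt_of_lt_of_le hs h)).symm

/-- The path of the dilution with target belief `Q` and interarrival times `e`. -/
noncomputable def dilutionPath {X : Type*} [Fintype X] (q₀ : Belief X)
    (z : Belief X × (ℕ → ℝ≥0)) : PathSpace X :=
  ⟨dilutionFun q₀ z.1 z.2, isCadlag_dilutionFun q₀ z.1 z.2⟩

/-- The law of the `α`-dilution of `π` (for `0 < α`): `Q` has law `π`, and the interarrival times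
are i.i.d. exponential of rate `α` and independent of `Q`. -/
noncomputable def dilutionLaw {X : Type*} [Fintype X] (q₀ : Belief X)
    (π : ProbabilityMeasure (Belief X)) (α : ℝ) : Measure (PathSpace X) :=
  ((π : Measure (Belief X)).prod
    (Measure.infinitePi (fun _ : ℕ => (expMeasure α).map Real.toNNReal))).map (dilutionPath q₀)

/-- The first time at which the belief differs from its initial value (`⊤` if there is none). -/
noncomputable def jumpTime {X : Type*} [Fintype X] (ω : PathSpace X) : WithTop ℝ≥0 :=
  sInf ((fun t : ℝ≥0 => (t : WithTop ℝ≥0)) '' {t : ℝ≥0 | belief t ω ≠ belief 0 ω})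

end Engagement

/-! The relaxed problem bounds every feasible policy from above, and the dilution of a relaxed
solution attains the bound.

Upper bound (`Environment.IsFeasible.exists_outcome`). Let `π` be the law of the belief at which the
agent stops. Optional stopping gives it mean `q₀`, and the information identity gives `E[I_τ] =
E^π[H(q) - H(q₀)]`. Stopping at once is available to the agent, so `κ E[τ] ≤ E^π[uhat(q) -
uhat(q₀)]`; the capacity bound gives `E[I_τ] ≤ χ E[τ]`. Eliminating `E[τ]` yields the relaxed
constraint, and the engagement is the relaxed objective.

Existence (`Environment.exists_relaxedSolution`). Objective and constraints depend on `π` only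
through finitely many moments. The attainable moment vectors form the convex hull of a compact set,
hence a compact set, and each of them is attained with finite support.

Attainment. If the optimal gain is zero, strict Jensen makes every feasible outcome degenerate, so
the delay has expected cost zero and the agent stops at once. If the gain is positive, an optimal
`π` has no atom at the prior (`Environment.IsRelaxedSolution.ae_ne`), so the dilution of rate `α = χ
/ gain` moves exactly at its first arrival. That time is exponential with mean `1 / α`, and both `H`
and `χ t` gain `χ E[t ∧ τ]` on average up to `t ∧ τ`; before the jump the past is uninformative, so
the same balance holds conditionally. A stopping time can react to nothing before the jump, so there
it amounts to a deterministic date; the relaxed constraint says that waiting is worth its expected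
delay, so no such date beats waiting (`Environment.agentPayoff_dilutionLaw_le`). -/

/-- In finite dimension the convex hull of a compact set is compact. -/
theorem IsCompact.convexHull_of_finiteDimensional {E : Type*} [NormedAddCommGroup E]
    [NormedSpace ℝ E] [FiniteDimensional ℝ E] {s : Set E} (hs : IsCompact s) :
    IsCompact (convexHull ℝ s) := by
  rcases s.eq_empty_or_nonempty with rfl | ⟨x₀, hx₀⟩
  · simp
  let n := Module.finrank ℝ E + 1
  let F : (Fin n → ℝ) × (Fin n → E) → E := fun p => ∑ i, p.1 i • p.2 i
  have hF : Continuous F := by fun_prop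
  have hc : IsCompact (stdSimplex ℝ (Fin n) ×ˢ Set.pi Set.univ (fun _ : Fin n => s)) :=
    (isCompact_stdSimplex ℝ _).prod (isCompact_univ_pi fun _ => hs)
  convert hc.image hF
  ext x
  constructor
  · intro hx
    obtain ⟨ι, _, z, w, hz, hai, hw, hw1, rfl⟩ := eq_pos_convex_span_of_mem_convexHull hx
    obtain ⟨e⟩ : Nonempty (ι ↪ Fin n) := Function.Embedding.nonempty_of_card_le (by
      simpa [n] using hai.card_le_finrank_succ.trans
        (Nat.succ_le_succ (Submodule.finrank_le _)))
    have hout : ∀ i ∉ Set.range e, Function.extend e w 0 i = 0 := fun i hi => by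
      rw [Function.extend_apply' _ _ _ (by simpa using hi)]; rfl
    -- Fewer than `n` points are padded with weight zero at the base point `x₀`.
    refine ⟨(Function.extend e w 0, Function.extend e z (fun _ => x₀)), ⟨⟨?_, ?_⟩, ?_⟩, ?_⟩
    · intro i
      by_cases hi : i ∈ Set.range e
      · obtain ⟨j, rfl⟩ := hi
        simpa [e.injective.extend_apply] using (hw j).le
      · exact (hout i hi).ge
    · rw [← hw1]
      exact (Fintype.sum_of_injective e e.injective _ _ hout
        (fun i => (e.injective.extend_apply _ _ _).symm)).symm
    · intro i _
      by_cases hi : i ∈ Set.range e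
      · obtain ⟨j, rfl⟩ := hi
        simpa [e.injective.extend_apply] using hz ⟨j, rfl⟩
      · simpa [Function.extend_apply' _ _ _ (by simpa using hi)] using hx₀
    · refine (Fintype.sum_of_injective e e.injective _ _ (fun i hi => ?_) (fun i => ?_)).symm
      · simp [hout i hi]
      · simp [e.injective.extend_apply]
  · rintro ⟨⟨w, z⟩, ⟨⟨hw, hw1⟩, hz⟩, rfl⟩
    exact (convex_convexHull ℝ s).sum_mem (fun i _ => hw i) hw1
      (fun i _ => subset_convexHull ℝ s (hz i (Set.mem_univ i)))

/-- Every point of the convex hull of the range of a map is the integral of that map against a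
probability measure of finite support. -/
theorem exists_finite_support_integral_eq {S E : Type*} [TopologicalSpace S] [T1Space S]
    [MeasurableSpace S] [BorelSpace S] [NormedAddCommGroup E] [NormedSpace ℝ E] [CompleteSpace E]
    {Φ : S → E} {v : E} (hv : v ∈ convexHull ℝ (Set.range Φ)) :
    ∃ π : ProbabilityMeasure S, (π : Measure S).support.Finite ∧
      ∫ q, Φ q ∂(π : Measure S) = v := by
  obtain ⟨ι, _, z, w, hz, -, hw, hw1, rfl⟩ := eq_pos_convex_span_of_mem_convexHull hv
  choose y hy using fun i => hz ⟨i, rfl⟩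
  let μ : Measure S := ∑ i, ENNReal.ofReal (w i) • Measure.dirac (y i)
  have hμ : IsProbabilityMeasure μ := ⟨by
    simp only [μ, Measure.coe_finsetSum, Finset.sum_apply, Measure.smul_apply, measure_univ,
      smul_eq_mul, mul_one]
    rw [← ENNReal.ofReal_sum_of_nonneg fun i _ => (hw i).le, hw1, ENNReal.ofReal_one]⟩
  refine ⟨⟨μ, hμ⟩, (Set.finite_range y).subset ?_, ?_⟩
  · refine Measure.support_subset_of_isClosed (Set.finite_range y).isClosed ?_
    change μ (Set.range y)ᶜ = 0
    have hm : MeasurableSet (Set.range y)ᶜ := (Set.finite_range y).isClosed.measurableSet.compl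
    simp [μ, Measure.dirac_apply' _ hm]
  · change ∫ q, Φ q ∂μ = _
    rw [integral_finsetSum_measure fun i _ =>
      (integrable_dirac (by finiteness)).smul_measure ENNReal.ofReal_ne_top]
    refine Finset.sum_congr rfl fun i _ => ?_
    rw [integral_smul_measure, integral_dirac, ENNReal.toReal_ofReal (hw i).le, hy]

/-! ### The relaxed static problem: existence and structure of solutions. -/

namespace Engagement

section Static

set_option linter.unusedSectionVars false

variable {X A : Type*} [Fintype X] [Fintype A] [Nonempty A]

lemma Environment.continuous_H (M : Environment X A) : Continuous fun q : Belief X => M.H q :=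
  M.H_continuousOn.comp_continuous continuous_subtype_val fun q => q.2

lemma Environment.continuous_uhat (M : Environment X A) : Continuous M.uhat := by
  unfold Environment.uhat
  refine Continuous.finset_sup'_apply _ fun a _ => ?_
  exact continuous_finsetSum _ fun x _ =>
    ((continuous_apply x).comp continuous_subtype_val).mul continuous_const

lemma continuous_belief_coord (x : X) : Continuous fun q : Belief X => q x :=
  (continuous_apply x).comp continuous_subtype_val

lemma integrable_of_continuous {S : Type*} [TopologicalSpace S] [CompactSpace S]
    [MeasurableSpace S] [BorelSpace S] {E : Type*} [NormedAddCommGroup E]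
    [SecondCountableTopology E] {f : S → E} (hf : Continuous f)
    (μ : Measure S) [IsFiniteMeasure μ] : Integrable f μ := by
  borelize E
  exact BoundedContinuousFunction.integrable μ (BoundedContinuousFunction.mkOfCompact ⟨f, hf⟩)

lemma Environment.integrable_H (M : Environment X A) (μ : Measure (Belief X)) [IsFiniteMeasure μ] :
    Integrable (fun q : Belief X => M.H q) μ := integrable_of_continuous M.continuous_H μ

lemma Environment.integrable_uhat (M : Environment X A) (μ : Measure (Belief X))
    [IsFiniteMeasure μ] : Integrable M.uhat μ := integrable_of_continuous M.continuous_uhat μ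

lemma integral_coe_eq_of_mean {q₀ : Belief X} {π : ProbabilityMeasure (Belief X)}
    (h : ∀ x, ∫ q, q x ∂(π : Measure (Belief X)) = q₀ x) :
    ∫ q, (q : X → ℝ) ∂(π : Measure (Belief X)) = (q₀ : X → ℝ) := by
  ext x
  rw [← h x, eval_integral]
  exact fun i => integrable_of_continuous (continuous_belief_coord i) _

/-- Jensen: a measure with mean `q₀` and non-positive information gain is concentrated at `q₀`. -/
lemma Environment.ae_eq_of_infoGain_nonpos (M : Environment X A) {q₀ : Belief X}
    {π : ProbabilityMeasure (Belief X)} (h : ∀ x, ∫ q, q x ∂(π : Measure (Belief X)) = q₀ x)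
    (hπ : M.infoGain q₀ π ≤ 0) : ∀ᵐ q ∂(π : Measure (Belief X)), q = q₀ := by
  obtain ⟨m, hm, hsc⟩ := M.H_strongConvexOn
  have hmean := integral_coe_eq_of_mean h
  have hint : Integrable (fun q : Belief X => (q : X → ℝ)) (π : Measure (Belief X)) :=
    integrable_of_continuous continuous_subtype_val _
  have := (hsc.strictConvexOn hm).ae_eq_const_or_map_average_lt
    (μ := (π : Measure (Belief X))) (f := fun q : Belief X => (q : X → ℝ)) M.H_continuousOn
    (isClosed_stdSimplex ℝ X) (Eventually.of_forall fun q => q.2) hint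
    (M.integrable_H (π : Measure (Belief X)))
  rw [average_eq_integral, hmean] at this
  -- Strict Jensen leaves two cases: a degenerate measure, or a strictly positive gain, which is
  -- excluded.
  rcases this with h1 | h1
  · filter_upwards [h1] with q hq using Subtype.ext hq
  · rw [average_eq_integral] at h1
    unfold Environment.infoGain at hπ
    rw [integral_sub (M.integrable_H _) (integrable_const _)] at hπ
    simp at hπ
    linarith

lemma Environment.infoGain_eq_zero_of_ae_eq (M : Environment X A) {q₀ : Belief X}
    {π : ProbabilityMeasure (Belief X)} (h : ∀ᵐ q ∂(π : Measure (Belief X)), q = q₀) :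
    M.infoGain q₀ π = 0 := by
  refine integral_eq_zero_of_ae ?_
  filter_upwards [h] with q hq
  simp [hq]

lemma support_eq_singleton_iff {q₀ : Belief X} {π : ProbabilityMeasure (Belief X)} :
    (π : Measure (Belief X)).support = {q₀} ↔ ∀ᵐ q ∂(π : Measure (Belief X)), q = q₀ := by
  constructor
  · intro h
    filter_upwards [Measure.support_mem_ae (μ := (π : Measure (Belief X)))] with q hq
    simpa [h] using hq
  · intro h
    have hsub : (π : Measure (Belief X)).support ⊆ {q₀} :=
      Measure.support_subset_of_isClosed isClosed_singleton h
    exact (Set.subset_singleton_iff_eq.1 hsub).resolve_left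
      (Measure.nonempty_support (IsProbabilityMeasure.ne_zero _)).ne_empty

/-- The moments of a posterior distribution that enter the relaxed problem. -/
noncomputable def Environment.moments (M : Environment X A) (q₀ q : Belief X) :
    (X → ℝ) × ℝ × ℝ := (q, M.H q - M.H q₀, M.uhat q - M.uhat q₀)

lemma Environment.continuous_moments (M : Environment X A) (q₀ : Belief X) :
    Continuous (M.moments q₀) :=
  continuous_subtype_val.prodMk ((M.continuous_H.sub continuous_const).prodMk
    (M.continuous_uhat.sub continuous_const))

lemma Environment.integral_moments (M : Environment X A) (q₀ : Belief X)
    (π : ProbabilityMeasure (Belief X)) :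
    ∫ q, M.moments q₀ q ∂(π : Measure (Belief X)) =
      (fun x => ∫ q, q x ∂(π : Measure (Belief X)), M.infoGain q₀ π,
        ∫ q, (M.uhat q - M.uhat q₀) ∂(π : Measure (Belief X))) := by
  have h1 : Integrable (fun q : Belief X => (q : X → ℝ)) (π : Measure (Belief X)) :=
    integrable_of_continuous continuous_subtype_val _
  have h2 : Integrable (fun q : Belief X => M.H q - M.H q₀) (π : Measure (Belief X)) :=
    integrable_of_continuous (M.continuous_H.sub continuous_const) _
  have h3 : Integrable (fun q : Belief X => M.uhat q - M.uhat q₀) (π : Measure (Belief X)) :=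
    integrable_of_continuous (M.continuous_uhat.sub continuous_const) _
  unfold Environment.moments
  rw [integral_pair h1 (h2.prodMk h3), integral_pair h2 h3]
  congr 1
  ext x
  rw [eval_integral]
  exact fun i => integrable_of_continuous (continuous_belief_coord i) _

/-- In moment space the problem maximizes a linear coordinate over the compact convex hull of the
moment map, cut by a closed set; the point mass at the prior shows that this set is nonempty. The
maximizer lies in a convex hull, hence comes from a measure of finite support. -/
theorem Environment.exists_relaxedSolution (M : Environment X A) (q₀ : Belief X) :
    ∃ π : ProbabilityMeasure (Belief X),
      M.IsRelaxedSolution q₀ π ∧ (π : Measure (Belief X)).support.Finite := by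
  let K := convexHull ℝ (Set.range (M.moments q₀))
  have hK : IsCompact K :=
    (isCompact_range (M.continuous_moments q₀)).convexHull_of_finiteDimensional
  let C := {v : (X → ℝ) × ℝ × ℝ | v.1 = q₀ ∧ M.κ / M.χ * v.2.1 ≤ v.2.2}
  have hC : IsClosed C :=
    (isClosed_eq continuous_fst continuous_const).inter
      (isClosed_le (continuous_const.mul continuous_snd.fst) continuous_snd.snd)
  have hmem : ∀ π : ProbabilityMeasure (Belief X), M.IsRelaxedFeasible q₀ π →
      ∫ q, M.moments q₀ q ∂(π : Measure (Belief X)) ∈ K ∩ C := fun π hπ => by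
    refine ⟨(convex_convexHull ℝ _).integral_mem hK.isClosed
      (Eventually.of_forall fun q => subset_convexHull ℝ _ ⟨q, rfl⟩)
      (integrable_of_continuous (M.continuous_moments q₀) _), ?_⟩
    rw [M.integral_moments]
    exact ⟨funext hπ.1, hπ.2⟩
  have hne : (K ∩ C).Nonempty :=
    ⟨M.moments q₀ q₀, subset_convexHull ℝ _ ⟨q₀, rfl⟩, rfl, by simp [Environment.moments]⟩
  obtain ⟨v, ⟨hvK, hvC⟩, hmax⟩ := (hK.inter_right hC).exists_isMaxOn hne
    (f := fun v => v.2.1) (by fun_prop)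
  obtain ⟨π, hfin, hπ⟩ := exists_finite_support_integral_eq hvK
  rw [M.integral_moments] at hπ
  subst hπ
  refine ⟨π, ⟨⟨fun x => congrFun hvC.1 x, hvC.2⟩, fun π' hπ' => ?_⟩, hfin⟩
  have := hmax (hmem π' hπ')
  rw [M.integral_moments] at this
  exact mul_le_mul_of_nonneg_left this M.ρ_pos.le

lemma Environment.IsRelaxedSolution.infoGain_le {M : Environment X A} {q₀ : Belief X}
    {π π' : ProbabilityMeasure (Belief X)} (h : M.IsRelaxedSolution q₀ π)
    (h' : M.IsRelaxedFeasible q₀ π') : M.infoGain q₀ π' ≤ M.infoGain q₀ π :=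
  le_of_mul_le_mul_left (h.2 π' h') M.ρ_pos

/-- An informative solution of the relaxed problem puts no mass on the prior: otherwise,
conditioning on moving away from the prior would be feasible and more informative. -/
lemma Environment.IsRelaxedSolution.ae_ne {M : Environment X A} {q₀ : Belief X}
    {π : ProbabilityMeasure (Belief X)} (h : M.IsRelaxedSolution q₀ π)
    (hpos : 0 < M.infoGain q₀ π) : ∀ᵐ q ∂(π : Measure (Belief X)), q ≠ q₀ := by
  set μ : Measure (Belief X) := (π : Measure (Belief X)) with hμ
  let s : Set (Belief X) := {q₀}ᶜ
  have hs : MeasurableSet s := (measurableSet_singleton q₀).compl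
  have hs0 : μ s ≠ 0 := fun h0 => by
    have : ∀ᵐ q ∂μ, q = q₀ := h0
    exact hpos.ne' (M.infoGain_eq_zero_of_ae_eq this)
  have hprob : IsProbabilityMeasure (ProbabilityTheory.cond μ s) :=
    ProbabilityTheory.cond_isProbabilityMeasure hs0
  let π' : ProbabilityMeasure (Belief X) := ⟨ProbabilityTheory.cond μ s, hprob⟩
  -- Every moment in the problem vanishes at `q₀`, so removing the atom there multiplies them all by
  -- the same factor `1 / μ s`. This preserves the constraints.
  have key : ∀ f : Belief X → ℝ, f q₀ = 0 →
      ∫ q, f q ∂(π' : Measure (Belief X)) = (μ.real s)⁻¹ * ∫ q, f q ∂μ := fun f hf => by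
    change ∫ q, f q ∂(ProbabilityTheory.cond μ s) = _
    rw [ProbabilityTheory.cond, integral_smul_measure, ENNReal.toReal_inv,
      setIntegral_eq_integral_of_forall_compl_eq_zero]
    · rfl
    · intro q hq
      simp only [s, Set.mem_compl_iff, Set.mem_singleton_iff, not_not] at hq
      rw [hq, hf]
  have hr0 : 0 < μ.real s := ENNReal.toReal_pos hs0 (measure_ne_top _ _)
  have hgain : M.infoGain q₀ π' = (μ.real s)⁻¹ * M.infoGain q₀ π :=
    key (fun q => M.H q - M.H q₀) (sub_self _)
  have hfeas : M.IsRelaxedFeasible q₀ π' := by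
    constructor
    · intro x
      have h1 := key (fun q => q x - q₀ x) (sub_self _)
      rw [integral_sub (integrable_of_continuous (continuous_belief_coord x) _)
        (integrable_const _), integral_sub (integrable_of_continuous (continuous_belief_coord x) _)
        (integrable_const _), h.1.1 x] at h1
      simpa [sub_eq_zero] using h1
    · rw [hgain, key (fun q => M.uhat q - M.uhat q₀) (sub_self _), mul_left_comm]
      exact mul_le_mul_of_nonneg_left h.1.2 (inv_nonneg.2 hr0.le)
  -- Maximality forbids a scale factor above one, so `μ s = 1`.
  have hle := h.infoGain_le hfeas
  rw [hgain] at hle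
  have h1 : (μ.real s)⁻¹ ≤ 1 := le_of_mul_le_mul_right (by simpa using hle) hpos
  have h2 : 1 ≤ μ.real s := by
    rwa [inv_le_one₀ hr0] at h1
  have h3 : μ s = 1 := by
    refine le_antisymm prob_le_one ?_
    rw [← ENNReal.ofReal_one, ← ENNReal.ofReal_toReal (measure_ne_top μ s)]
    exact ENNReal.ofReal_le_ofReal h2
  exact (prob_compl_eq_zero_iff hs).2 h3

end Static

end Engagement

/-! ### Discretization of time -/

/-- The largest multiple of `1 / (n + 1)` that is at most `t`. -/
noncomputable def gridFloor (n : ℕ) (t : ℝ≥0) : ℝ≥0 := ⌊(n + 1) * t⌋₊ / (n + 1)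

/-- The smallest multiple of `1 / (n + 1)` that is greater than `t`. -/
noncomputable def gridCeil (n : ℕ) (t : ℝ≥0) : ℝ≥0 := (⌊(n + 1) * t⌋₊ + 1) / (n + 1)

lemma gridFloor_le (n : ℕ) (t : ℝ≥0) : gridFloor n t ≤ t := by
  rw [gridFloor, div_le_iff₀ (by positivity), mul_comm]
  exact Nat.floor_le zero_le

lemma lt_gridCeil (n : ℕ) (t : ℝ≥0) : t < gridCeil n t := by
  rw [gridCeil, lt_div_iff₀ (by positivity), mul_comm]
  exact Nat.lt_floor_add_one _

lemma gridCeil_eq (n : ℕ) (t : ℝ≥0) : gridCeil n t = gridFloor n t + 1 / (n + 1) := by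
  rw [gridCeil, gridFloor, add_div]

lemma gridCeil_le (n : ℕ) (t : ℝ≥0) : gridCeil n t ≤ t + 1 / (n + 1) := by
  rw [gridCeil_eq]
  gcongr
  exact gridFloor_le n t

lemma tendsto_one_div_add_one_nnreal :
    Tendsto (fun n : ℕ => 1 / ((n : ℝ≥0) + 1)) atTop (𝓝 0) := by
  rw [← NNReal.tendsto_coe]
  simpa using tendsto_one_div_add_atTop_nhds_zero_nat (𝕜 := ℝ)

lemma tendsto_gridCeil (t : ℝ≥0) : Tendsto (fun n => gridCeil n t) atTop (𝓝 t) := by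
  refine tendsto_of_tendsto_of_tendsto_of_le_of_le tendsto_const_nhds ?_
    (fun n => (lt_gridCeil n t).le) (fun n => gridCeil_le n t)
  simpa using tendsto_const_nhds.add tendsto_one_div_add_one_nnreal

lemma tendsto_gridCeil_Ici (t : ℝ≥0) :
    Tendsto (fun n => gridCeil n t) atTop (𝓝[Set.Ici t] t) :=
  tendsto_nhdsWithin_iff.2
    ⟨tendsto_gridCeil t, Eventually.of_forall fun n => (lt_gridCeil n t).le⟩

lemma gridCeil_le_iff (n : ℕ) (t s : ℝ≥0) : gridCeil n t ≤ s ↔ t < gridFloor n s := by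
  rw [gridCeil, gridFloor, div_le_iff₀ (by positivity), lt_div_iff₀ (by positivity),
    mul_comm s, mul_comm t, ← Nat.floor_lt zero_le, ← Nat.succ_le_iff,
    Nat.le_floor_iff zero_le, Nat.cast_succ]

/-- A process evaluated at a discretized random time is measurable. -/
lemma measurable_comp_of_countable {Ω β γ : Type*} [MeasurableSpace Ω] [MeasurableSpace β]
    [MeasurableSpace γ] {u : ℝ≥0 → Ω → β} (hu : ∀ t, Measurable (u t)) {k : γ → ℕ}
    (hk : Measurable k) {g : γ → Ω} (hg : Measurable g) (c : ℕ → ℝ≥0) :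
    Measurable fun y => u (c (k y)) (g y) := by
  have : Measurable fun p : ℕ × Ω => u (c p.1) p.2 :=
    measurable_from_prod_countable_right fun n => hu (c n)
  exact this.comp (hk.prodMk hg)

lemma measurable_gridIndex (n : ℕ) : Measurable fun t : ℝ≥0 => ⌊((n : ℝ≥0) + 1) * t⌋₊ :=
  Nat.measurable_floor.comp (measurable_const.mul measurable_id)

/-! ### Measurability and optional stopping for càdlàg belief paths. -/

namespace Engagement

section Paths

set_option linter.unusedSectionVars false

variable {X : Type*} [Fintype X]

lemma tendsto_belief_gridCeil (ω : PathSpace X) (t : ℝ≥0) :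
    Tendsto (fun n => belief (gridCeil n t) ω) atTop (𝓝 (belief t ω)) :=
  (ω.2 t).1.tendsto.comp (tendsto_gridCeil_Ici t)

/-- Right continuity makes the belief a limit of its values at grid times just after `t`, which are
jointly measurable because there are countably many of them. -/
lemma measurable_uncurry_belief :
    Measurable fun p : ℝ≥0 × PathSpace X => belief p.1 p.2 := by
  refine measurable_of_tendsto_metrizable
    (f := fun n (p : ℝ≥0 × PathSpace X) => belief (gridCeil n p.1) p.2) (fun n => ?_)
    (tendsto_pi_nhds.2 fun p => tendsto_belief_gridCeil p.2 p.1)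
  exact measurable_comp_of_countable (fun t => measurable_belief t)
    ((measurable_gridIndex n).comp measurable_fst) measurable_snd
    (fun k => ((k : ℝ≥0) + 1) / (n + 1))

lemma measurable_stoppedValue_belief {τ : PathSpace X → WithTop ℝ≥0} (hτ : Measurable τ) :
    Measurable (stoppedValue belief τ : PathSpace X → Belief X) :=
  measurable_uncurry_belief.comp (hτ.untopA.prodMk measurable_id)

lemma measurable_min_const {τ : PathSpace X → WithTop ℝ≥0} (hτ : Measurable τ) (t : ℝ≥0) :
    Measurable fun ω => min (t : WithTop ℝ≥0) (τ ω) :=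
  measurable_const.min hτ

lemma measurable_stoppedProcess_belief {τ : PathSpace X → WithTop ℝ≥0} (hτ : Measurable τ)
    (t : ℝ≥0) : Measurable (stoppedProcess belief τ t : PathSpace X → Belief X) :=
  measurable_stoppedValue_belief (measurable_min_const hτ t)

lemma coe_untopA_min (t : ℝ≥0) (a : WithTop ℝ≥0) :
    (((min (t : WithTop ℝ≥0) a).untopA : ℝ≥0) : WithTop ℝ≥0) = min (t : WithTop ℝ≥0) a := by
  rw [WithTop.untopA_eq_untop (ne_top_of_le_ne_top WithTop.coe_ne_top (min_le_left _ _))]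
  exact WithTop.coe_untop _ _

lemma untopA_min_coe (t s : ℝ≥0) : (min (t : WithTop ℝ≥0) (s : WithTop ℝ≥0)).untopA = min t s := by
  rw [← WithTop.coe_inj, coe_untopA_min]; rfl

/-- The stopping time `τ`, rounded up to the grid and truncated at `N`. -/
noncomputable def gridStop (τ : PathSpace X → WithTop ℝ≥0) (N : ℝ≥0) (n : ℕ) (ω : PathSpace X) :
    WithTop ℝ≥0 :=
  min (N : WithTop ℝ≥0) ((τ ω).map (gridCeil n))

/-- Since rounding is strictly upward, the rounded time is at most `t` exactly when `τ < gridFloor n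
t`, an event already known at `t`. -/
lemma isStoppingTime_gridStop {τ : PathSpace X → WithTop ℝ≥0}
    (hτ : IsStoppingTime (naturalFiltration X) τ) (N : ℝ≥0) (n : ℕ) :
    IsStoppingTime (naturalFiltration X) (gridStop τ N n) := by
  refine IsStoppingTime.min (isStoppingTime_const _ N) fun t => ?_
  convert hτ.measurableSet_lt_le (gridFloor_le n t) using 1
  ext ω
  simp only [Set.mem_ofPred_eq]
  cases h : τ ω with
  | top => exact iff_of_false (fun h => WithTop.coe_ne_top (top_le_iff.1 h)) not_top_lt
  | coe s =>
    rw [WithTop.map_coe, WithTop.coe_le_coe, WithTop.coe_lt_coe]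
    exact gridCeil_le_iff n s t

lemma countable_range_gridStop (τ : PathSpace X → WithTop ℝ≥0) (N : ℝ≥0) (n : ℕ) :
    (Set.range (gridStop τ N n)).Countable := by
  refine ((Set.countable_range fun k : ℕ =>
    min (N : WithTop ℝ≥0) ((((k : ℝ≥0) + 1) / (n + 1) : ℝ≥0) : WithTop ℝ≥0)).union
    (Set.countable_singleton (N : WithTop ℝ≥0))).mono ?_
  rintro _ ⟨ω, rfl⟩
  unfold gridStop
  cases h : τ ω with
  | top => right; exact min_top_right _
  | coe s => left; exact ⟨⌊((n : ℝ≥0) + 1) * s⌋₊, rfl⟩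

lemma tendsto_stoppedValue_gridStop (τ : PathSpace X → WithTop ℝ≥0) (N : ℝ≥0) (ω : PathSpace X) :
    Tendsto (fun n => stoppedValue belief (gridStop τ N n) ω) atTop
      (𝓝 (stoppedProcess belief τ N ω)) := by
  simp only [stoppedValue, stoppedProcess, gridStop]
  cases h : τ ω with
  | top => simp
  | coe s =>
    simp only [WithTop.map_coe, untopA_min_coe]
    refine (ω.2 (min N s)).1.tendsto.comp (tendsto_nhdsWithin_iff.2 ⟨?_, ?_⟩)
    · exact tendsto_const_nhds.min (tendsto_gridCeil s)
    · exact Eventually.of_forall fun n => min_le_min le_rfl (lt_gridCeil n s).le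

lemma eventually_stoppedProcess_eq {Ω β : Type*} {τ : Ω → WithTop ℝ≥0} {ω : Ω} (h : τ ω ≠ ⊤)
    (u : ℝ≥0 → Ω → β) :
    ∀ᶠ N : ℕ in atTop, stoppedProcess u τ N ω = stoppedValue u τ ω := by
  lift τ ω to ℝ≥0 using h with s hs
  filter_upwards [eventually_ge_atTop ⌈s⌉₊] with N hN
  have : s ≤ (N : ℝ≥0) := (Nat.le_ceil s).trans (by exact_mod_cast hN)
  simp only [stoppedProcess, stoppedValue, ← hs, untopA_min_coe, min_eq_right this]
  rfl

lemma tendsto_stoppedProcess {Ω β : Type*} [TopologicalSpace β] {τ : Ω → WithTop ℝ≥0} {ω : Ω}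
    (h : τ ω ≠ ⊤) (u : ℝ≥0 → Ω → β) :
    Tendsto (fun N : ℕ => stoppedProcess u τ N ω) atTop (𝓝 (stoppedValue u τ ω)) :=
  tendsto_const_nhds.congr' ((eventually_stoppedProcess_eq h u).mono fun _ h => h.symm)

lemma norm_belief_apply_le (q : Belief X) (x : X) : ‖q x‖ ≤ 1 := by
  change ‖q.1 x‖ ≤ 1
  rw [Real.norm_of_nonneg (q.2.1 x), ← q.2.2]
  exact Finset.single_le_sum (fun i _ => q.2.1 i) (Finset.mem_univ x)

/-- Optional stopping for the belief martingale at a bounded time. -/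
lemma integral_stoppedProcess_belief {P : Measure (PathSpace X)} [IsProbabilityMeasure P]
    (hM : Martingale (fun t ω => (belief t ω : X → ℝ)) (naturalFiltration X) P)
    {τ : PathSpace X → WithTop ℝ≥0} (hτ : IsStoppingTime (naturalFiltration X) τ) (N : ℝ≥0) :
    ∫ ω, ((stoppedProcess belief τ N ω : Belief X) : X → ℝ) ∂P = ∫ ω, (belief 0 ω : X → ℝ) ∂P := by
  have hbound : ∀ q : Belief X, ‖(q : X → ℝ)‖ ≤ 1 := fun q => by
    rw [pi_norm_le_iff_of_nonneg zero_le_one]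
    exact norm_belief_apply_le q
  -- Optional stopping holds for times of countable range. The grid times approach `τ ∧ N` from the
  -- right, so right continuity and bounded convergence then give the limit.
  have hstep : ∀ n, ∫ ω, ((stoppedValue belief (gridStop τ N n) ω : Belief X) : X → ℝ) ∂P =
      ∫ ω, (belief 0 ω : X → ℝ) ∂P := fun n => by
    have hst := isStoppingTime_gridStop hτ N n
    have hle : ∀ ω, gridStop τ N n ω ≤ N := fun ω => min_le_left _ _
    have h1 := hM.stoppedValue_ae_eq_condExp_of_le_const_of_countable_range hst hle
      (countable_range_gridStop τ N n)
    have h2 : ∫ ω, (belief 0 ω : X → ℝ) ∂P = ∫ ω, (belief N ω : X → ℝ) ∂P := by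
      simpa using hM.setIntegral_eq (zero_le : 0 ≤ N) (s := Set.univ) MeasurableSet.univ
    rw [h2, ← integral_condExp (f := fun ω => (belief N ω : X → ℝ))
      (hst.measurableSpace_le_of_le hle)]
    exact integral_congr_ae h1
  refine tendsto_nhds_unique (tendsto_integral_of_dominated_convergence
    (F := fun n ω => ((stoppedValue belief (gridStop τ N n) ω : Belief X) : X → ℝ)) (fun _ => 1)
    (fun n => ?_) (integrable_const _) (fun n => Eventually.of_forall fun ω => hbound _)
    (Eventually.of_forall fun ω => ?_)) ?_
  · exact (measurable_subtype_coe.comp (measurable_stoppedValue_belief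
      (isStoppingTime_gridStop hτ N n).measurable')).aestronglyMeasurable
  · exact (continuous_subtype_val.tendsto _).comp (tendsto_stoppedValue_gridStop τ N ω)
  · simp only [hstep]
    exact tendsto_const_nhds

lemma integrable_continuous_comp {Ω : Type*} [MeasurableSpace Ω] {P : Measure Ω}
    [IsFiniteMeasure P] {B : Ω → Belief X} (hB : Measurable B) {E : Type*}
    [NormedAddCommGroup E] [SecondCountableTopology E] {f : Belief X → E} (hf : Continuous f) :
    Integrable (fun ω => f (B ω)) P := by
  borelize E
  obtain ⟨C, hC⟩ := isCompact_univ.exists_bound_of_continuousOn hf.continuousOn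
  exact Integrable.of_bound (hf.measurable.comp hB).aestronglyMeasurable C
    (Eventually.of_forall fun ω => hC _ (Set.mem_univ _))

/-- The expectation of a continuous function of the stopped belief converges to that of the belief
at an almost surely finite stopping time. -/
lemma tendsto_integral_stoppedProcess {P : Measure (PathSpace X)} [IsProbabilityMeasure P]
    {τ : PathSpace X → WithTop ℝ≥0} (hτ : IsAdmissibleTime P τ) {E : Type*}
    [NormedAddCommGroup E] [NormedSpace ℝ E] [SecondCountableTopology E]
    {f : Belief X → E} (hf : Continuous f) :
    Tendsto (fun N : ℕ => ∫ ω, f (stoppedProcess belief τ N ω) ∂P) atTop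
      (𝓝 (∫ ω, f (stoppedValue belief τ ω) ∂P)) := by
  borelize E
  obtain ⟨C, hC⟩ := isCompact_univ.exists_bound_of_continuousOn hf.continuousOn
  refine tendsto_integral_of_dominated_convergence (fun _ => C) (fun n => ?_)
    (integrable_const _) (fun n => Eventually.of_forall fun ω => hC _ (Set.mem_univ _)) ?_
  · exact (hf.measurable.comp
      (measurable_stoppedProcess_belief hτ.1.measurable' n)).aestronglyMeasurable
  · filter_upwards [hτ.2] with ω hω
    exact (hf.tendsto _).comp (tendsto_stoppedProcess hω belief)

end Paths

end Engagement

/-! ### The upper bound: outcomes of policies and of feasible policies. -/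

namespace Engagement

section Policies

set_option linter.unusedSectionVars false

variable {X A : Type*} [Fintype X] [Fintype A] [Nonempty A] {M : Environment X A} {q₀ : Belief X}
  {P : Measure (PathSpace X)} {I : ℝ≥0 → PathSpace X → ℝ} {τ : PathSpace X → WithTop ℝ≥0}

lemma Environment.IsPolicy.information_bounds (h : M.IsPolicy q₀ P I τ) :
    ∀ᵐ ω ∂P, ∀ t : ℝ≥0, (t : WithTop ℝ≥0) ≤ τ ω → 0 ≤ I t ω ∧ I t ω ≤ M.χ * t := by
  filter_upwards [h.initial, h.increasing, h.capacity] with ω h0 hm hc t ht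
  have h1 : I 0 ω ≤ I t ω := hm (zero_le : 0 ≤ t)
  have h2 := hc 0 t zero_le ht
  rw [h0] at h1 h2
  simp only [sub_zero, NNReal.coe_zero] at h2
  exact ⟨h1, h2⟩

lemma coe_untopA_min_le (N : ℝ≥0) (a : WithTop ℝ≥0) :
    (((min (N : WithTop ℝ≥0) a).untopA : ℝ≥0) : WithTop ℝ≥0) ≤ a := by
  rw [coe_untopA_min]
  exact min_le_right _ _

lemma untopA_min_le (N : ℝ≥0) (a : WithTop ℝ≥0) : (min (N : WithTop ℝ≥0) a).untopA ≤ N := by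
  rw [← WithTop.coe_le_coe, coe_untopA_min]
  exact min_le_left _ _

lemma untopA_min_mono {N N' : ℝ≥0} (h : N ≤ N') (a : WithTop ℝ≥0) :
    (min (N : WithTop ℝ≥0) a).untopA ≤ (min (N' : WithTop ℝ≥0) a).untopA := by
  rw [← WithTop.coe_le_coe, coe_untopA_min, coe_untopA_min]
  exact min_le_min (WithTop.coe_le_coe.2 h) le_rfl

/-- No path regularity of `I` is assumed, but monotonicity and the capacity bound make it Lipschitz
up to `τ`. Grid times are rounded down because this control ends at `τ`. -/
lemma Environment.IsPolicy.aemeasurable_stopped (h : M.IsPolicy q₀ P I τ) (N : ℝ≥0) :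
    AEMeasurable (stoppedProcess I τ N) P := by
  let T : PathSpace X → ℝ≥0 := fun ω => (min (N : WithTop ℝ≥0) (τ ω)).untopA
  have hT : Measurable T := (measurable_min_const h.stopping.1.measurable' N).untopA
  refine aemeasurable_of_tendsto_metrizable_ae atTop
    (f := fun (n : ℕ) ω => I (gridFloor n (T ω)) ω) (fun n => ?_) ?_
  · exact (measurable_comp_of_countable
      (fun t => (h.adapted t).mono ((naturalFiltration X).le t) le_rfl)
      ((measurable_gridIndex n).comp hT) measurable_id
      (fun k => (k : ℝ≥0) / (n + 1))).aemeasurable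
  · filter_upwards [h.increasing, h.capacity] with ω hm hc
    have hlow : ∀ n : ℕ, I (T ω) ω - M.χ * (1 / ((n : ℝ) + 1)) ≤ I (gridFloor n (T ω)) ω := by
      intro n
      have h1 := hc _ _ (gridFloor_le n (T ω)) (coe_untopA_min_le N (τ ω))
      have h2 : (T ω : ℝ) ≤ gridFloor n (T ω) + 1 / ((n : ℝ) + 1) := by
        have := (lt_gridCeil n (T ω)).le
        rw [gridCeil_eq] at this
        exact_mod_cast this
      have h3 : M.χ * ((T ω : ℝ) - gridFloor n (T ω)) ≤ M.χ * (1 / ((n : ℝ) + 1)) :=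
        mul_le_mul_of_nonneg_left (by linarith) M.χ_pos.le
      linarith
    refine tendsto_of_tendsto_of_tendsto_of_le_of_le ?_ tendsto_const_nhds hlow
      fun n => hm (gridFloor_le n (T ω))
    change Tendsto _ _ (𝓝 (I (T ω) ω))
    simpa using tendsto_const_nhds.sub
      (tendsto_one_div_add_atTop_nhds_zero_nat (𝕜 := ℝ) |>.const_mul M.χ)

/-- Up to a bounded time, the expected cumulative information is the expected increase of `H`. -/
lemma Environment.IsPolicy.lintegral_stopped (h : M.IsPolicy q₀ P I τ) (N : ℝ≥0) :
    ∫⁻ ω, ENNReal.ofReal (stoppedProcess I τ N ω) ∂P =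
      ENNReal.ofReal ((∫ ω, M.H (stoppedProcess belief τ N ω : Belief X) ∂P) - M.H q₀) := by
  have := h.isProbabilityMeasure
  have hb : ∀ᵐ ω ∂P, 0 ≤ stoppedProcess I τ N ω ∧ stoppedProcess I τ N ω ≤ M.χ * N := by
    filter_upwards [h.information_bounds] with ω hω
    obtain ⟨h1, h2⟩ := hω _ (coe_untopA_min_le N (τ ω))
    exact ⟨h1, h2.trans (mul_le_mul_of_nonneg_left (untopA_min_le N _) M.χ_pos.le)⟩
  have hint : Integrable (stoppedProcess I τ N) P :=
    Integrable.of_bound (h.aemeasurable_stopped N).aestronglyMeasurable (M.χ * N)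
      (hb.mono fun ω hω => by rw [Real.norm_of_nonneg hω.1]; exact hω.2)
  rw [← ofReal_integral_eq_lintegral_ofReal hint (hb.mono fun ω hω => hω.1)]
  congr 1
  have hz : ∀ ω, (min ((0 : ℝ≥0) : WithTop ℝ≥0) (τ ω)).untopA = 0 := fun ω =>
    le_antisymm (untopA_min_le 0 _) zero_le
  -- Only the unconditional identity from time `0` matters for the upper bound.
  have hinfo := integral_congr_ae (h.information 0 N zero_le)
  rw [integral_condExp ((naturalFiltration X).le 0),
    integral_condExp ((naturalFiltration X).le 0)] at hinfo
  have hH : Integrable (fun ω => M.H (stoppedProcess belief τ N ω : Belief X)) P :=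
    integrable_continuous_comp
      (measurable_stoppedProcess_belief h.stopping.1.measurable' N) M.continuous_H
  calc ∫ ω, stoppedProcess I τ N ω ∂P
      = ∫ ω, (stoppedProcess I τ N ω - stoppedProcess I τ 0 ω) ∂P := by
        refine integral_congr_ae ?_
        filter_upwards [h.initial] with ω hω
        have : stoppedProcess I τ 0 ω = 0 := by
          unfold stoppedProcess
          rw [hz, hω]
        rw [this, sub_zero]
    _ = ∫ ω, (M.H (stoppedProcess belief τ N ω : Belief X)
          - M.H (stoppedProcess belief τ 0 ω : Belief X)) ∂P := hinfo.symm
    _ = ∫ ω, (M.H (stoppedProcess belief τ N ω : Belief X) - M.H q₀) ∂P := by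
        refine integral_congr_ae ?_
        filter_upwards [h.prior] with ω hω
        have : (stoppedProcess belief τ 0 ω : Belief X) = q₀ := by
          unfold stoppedProcess
          rw [hz, hω]
        rw [this]
    _ = _ := by
        rw [integral_sub hH (integrable_const _)]
        simp

/-- The law of the belief at which the agent stops. -/
theorem Environment.IsPolicy.exists_outcome (h : M.IsPolicy q₀ P I τ) :
    ∃ π : ProbabilityMeasure (Belief X),
      (π : Measure (Belief X)) = P.map (stoppedValue belief τ) ∧
      (∀ x, ∫ q, q x ∂(π : Measure (Belief X)) = q₀ x) ∧
      ∫⁻ ω, ENNReal.ofReal (stoppedValue I τ ω) ∂P = ENNReal.ofReal (M.infoGain q₀ π) := by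
  have := h.isProbabilityMeasure
  have hmeas := measurable_stoppedValue_belief h.stopping.1.measurable'
  refine ⟨⟨P.map (stoppedValue belief τ), Measure.isProbabilityMeasure_map hmeas.aemeasurable⟩,
    rfl, ?_, ?_⟩
  · have hlim := tendsto_integral_stoppedProcess h.stopping
      (f := fun q : Belief X => (q : X → ℝ)) continuous_subtype_val
    simp only [integral_stoppedProcess_belief h.martingale h.stopping.1] at hlim
    have heq := tendsto_nhds_unique hlim tendsto_const_nhds
    have h0 : ∫ ω, (belief 0 ω : X → ℝ) ∂P = q₀ := by
      rw [integral_congr_ae (g := fun _ => (q₀ : X → ℝ)) (h.prior.mono fun ω hω => by simp [hω])]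
      simp
    intro x
    change ∫ q, q x ∂(P.map (stoppedValue belief τ)) = q₀ x
    rw [integral_map hmeas.aemeasurable (continuous_belief_coord x).aestronglyMeasurable,
      ← h0, ← heq, eval_integral]
    intro i
    exact integrable_continuous_comp hmeas (continuous_belief_coord i)
  -- As the horizon grows, `I` passes to the limit by monotone convergence, `H` by bounded
  -- convergence.
  · have hmono : Tendsto (fun N : ℕ => ∫⁻ ω, ENNReal.ofReal (stoppedProcess I τ N ω) ∂P) atTop
        (𝓝 (∫⁻ ω, ENNReal.ofReal (stoppedValue I τ ω) ∂P)) := by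
      refine lintegral_tendsto_of_tendsto_of_monotone
        (fun N => (h.aemeasurable_stopped N).ennreal_ofReal) ?_ ?_
      · filter_upwards [h.increasing] with ω hω N N' hN
        exact ENNReal.ofReal_le_ofReal (hω (untopA_min_mono (by exact_mod_cast hN) _))
      · filter_upwards [h.stopping.2] with ω hω
        exact (ENNReal.continuous_ofReal.tendsto _).comp (tendsto_stoppedProcess hω I)
    simp only [h.lintegral_stopped] at hmono
    refine tendsto_nhds_unique hmono ((ENNReal.continuous_ofReal.tendsto _).comp ?_)
    have hval : M.infoGain q₀ ⟨P.map (stoppedValue belief τ),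
        Measure.isProbabilityMeasure_map hmeas.aemeasurable⟩ =
        (∫ ω, M.H (stoppedValue belief τ ω : Belief X) ∂P) - M.H q₀ := by
      change ∫ q, (M.H q - M.H q₀) ∂(P.map (stoppedValue belief τ)) = _
      have := Measure.isProbabilityMeasure_map (μ := P) hmeas.aemeasurable
      rw [integral_sub (M.integrable_H _) (integrable_const _),
        integral_map hmeas.aemeasurable M.continuous_H.aestronglyMeasurable]
      simp
    rw [hval]
    exact (tendsto_integral_stoppedProcess h.stopping M.continuous_H).sub_const _

/-- As `κ > 0`, infinite expected delay means payoff `-∞`; a real lower bound therefore forces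
finite delay and reduces to real arithmetic. -/
lemma Environment.le_agentPayoff_iff (M : Environment X A) {P : Measure (PathSpace X)}
    {τ : PathSpace X → WithTop ℝ≥0} {r : ℝ} :
    (r : EReal) ≤ M.agentPayoff P τ ↔ ∫⁻ ω, ((τ ω).untopA : ℝ≥0∞) ∂P ≠ ⊤ ∧
      r ≤ (∫ ω, M.uhat (stoppedValue belief τ ω) ∂P)
        - M.κ * (∫⁻ ω, ((τ ω).untopA : ℝ≥0∞) ∂P).toReal := by
  unfold Environment.agentPayoff
  generalize (∫ ω, M.uhat (stoppedValue belief τ ω) ∂P) = U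
  generalize (∫⁻ ω, ((τ ω).untopA : ℝ≥0∞) ∂P) = D
  rcases eq_or_ne D ⊤ with rfl | hD
  · simp [ENNReal.mul_top, M.κ_pos]
  · rw [← ENNReal.ofReal_toReal hD, ← ENNReal.ofReal_mul M.κ_pos.le, EReal.coe_ennreal_ofReal,
      max_eq_left (mul_nonneg M.κ_pos.le ENNReal.toReal_nonneg),
      ENNReal.toReal_ofReal ENNReal.toReal_nonneg, ← EReal.coe_sub, EReal.coe_le_coe_iff]
    simp

lemma isAdmissibleTime_const (P : Measure (PathSpace X)) (t : ℝ≥0) :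
    IsAdmissibleTime P fun _ => (t : WithTop ℝ≥0) :=
  ⟨isStoppingTime_const _ t, Eventually.of_forall fun _ => WithTop.coe_ne_top⟩

lemma Environment.agentPayoff_zero [IsProbabilityMeasure P] (hP : ∀ᵐ ω ∂P, belief 0 ω = q₀) :
    M.agentPayoff P (fun _ => ((0 : ℝ≥0) : WithTop ℝ≥0)) = (M.uhat q₀ : EReal) := by
  unfold Environment.agentPayoff
  have h1 : ∫ ω, M.uhat (stoppedValue belief (fun _ => ((0 : ℝ≥0) : WithTop ℝ≥0)) ω) ∂P
      = M.uhat q₀ := by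
    rw [integral_congr_ae (g := fun _ => M.uhat q₀) (hP.mono fun ω hω => ?_)]
    · simp
    · change M.uhat (belief 0 ω) = _
      rw [hω]
  have h2 : ∀ ω : PathSpace X,
      (((fun _ => ((0 : ℝ≥0) : WithTop ℝ≥0)) ω : WithTop ℝ≥0).untopA : ℝ≥0∞) = 0 := fun _ => rfl
  rw [h1, lintegral_congr h2]
  simp

/-- The outcome of a feasible policy is feasible in the relaxed problem, its information gain is
the engagement, and the agent's expected payoff exceeds that of stopping at once. -/
theorem Environment.IsFeasible.exists_outcome (h : M.IsFeasible q₀ P I τ) :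
    ∃ π : ProbabilityMeasure (Belief X), M.IsRelaxedFeasible q₀ π ∧
      M.engagement P I τ = ENNReal.ofReal (M.ρ * M.infoGain q₀ π) ∧
      ∫⁻ ω, ((τ ω).untopA : ℝ≥0∞) ∂P ≠ ⊤ ∧
      M.κ * (∫⁻ ω, ((τ ω).untopA : ℝ≥0∞) ∂P).toReal ≤
        ∫ q, (M.uhat q - M.uhat q₀) ∂(π : Measure (Belief X)) := by
  have := h.1.isProbabilityMeasure
  obtain ⟨π, hπ, hmean, hinfo⟩ := h.1.exists_outcome
  have hmeas := measurable_stoppedValue_belief h.1.stopping.1.measurable'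
  -- The one deviation of the agent that is needed: stopping at time zero.
  have h0 := h.2.2 _ (isAdmissibleTime_const P 0)
  rw [Environment.agentPayoff_zero h.1.prior, M.le_agentPayoff_iff] at h0
  obtain ⟨hD, hle⟩ := h0
  have hU : ∫ q, (M.uhat q - M.uhat q₀) ∂(π : Measure (Belief X)) =
      (∫ ω, M.uhat (stoppedValue belief τ ω) ∂P) - M.uhat q₀ := by
    rw [integral_sub (M.integrable_uhat _) (integrable_const _), hπ,
      integral_map hmeas.aemeasurable M.continuous_uhat.aestronglyMeasurable, ← hπ]
    simp
  have hcost : M.κ * (∫⁻ ω, ((τ ω).untopA : ℝ≥0∞) ∂P).toReal ≤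
      ∫ q, (M.uhat q - M.uhat q₀) ∂(π : Measure (Belief X)) := by linarith
  refine ⟨π, ⟨hmean, ?_⟩, ?_, hD, hcost⟩
  · refine le_trans ?_ hcost
    -- Capacity bounds `I_τ` by `χ τ`, so the gain is at most `χ E[τ]`.
    have h1 : ENNReal.ofReal (M.infoGain q₀ π) ≤
        ENNReal.ofReal M.χ * ∫⁻ ω, ((τ ω).untopA : ℝ≥0∞) ∂P := by
      rw [← hinfo, ← lintegral_const_mul' _ _ ENNReal.ofReal_ne_top]
      refine lintegral_mono_ae ?_
      filter_upwards [h.1.information_bounds, h.1.stopping.2] with ω hω hfin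
      have hb := (hω (τ ω).untopA (by rw [WithTop.untopA_eq_untop hfin, WithTop.coe_untop])).2
      refine (ENNReal.ofReal_le_ofReal hb).trans ?_
      rw [ENNReal.ofReal_mul M.χ_pos.le, ENNReal.ofReal_coe_nnreal]
    rw [← ENNReal.ofReal_toReal hD, ← ENNReal.ofReal_mul M.χ_pos.le,
      ENNReal.ofReal_le_ofReal_iff (mul_nonneg M.χ_pos.le ENNReal.toReal_nonneg)] at h1
    calc M.κ / M.χ * M.infoGain q₀ π ≤ M.κ / M.χ * (M.χ * _) :=
          mul_le_mul_of_nonneg_left h1 (div_pos M.κ_pos M.χ_pos).le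
      _ = _ := by rw [← mul_assoc, div_mul_cancel₀ _ M.χ_pos.ne']
  · rw [Environment.engagement, hinfo, ENNReal.ofReal_mul M.ρ_pos.le]

theorem Environment.IsRelaxedSolution.engagement_le {π : ProbabilityMeasure (Belief X)}
    (hπ : M.IsRelaxedSolution q₀ π) (h : M.IsFeasible q₀ P I τ) :
    M.engagement P I τ ≤ ENNReal.ofReal (M.ρ * M.infoGain q₀ π) := by
  obtain ⟨π', hfeas, heng, -, -⟩ := h.exists_outcome
  rw [heng]
  exact ENNReal.ofReal_le_ofReal (hπ.2 π' hfeas)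

/-- If no informative posterior distribution is feasible in the relaxed problem, the agent stops
at once under every feasible policy. -/
theorem Environment.IsRelaxedSolution.stops_at_once {π : ProbabilityMeasure (Belief X)}
    (hπ : M.IsRelaxedSolution q₀ π) (h0 : M.infoGain q₀ π = 0) (h : M.IsFeasible q₀ P I τ) :
    ∀ᵐ ω ∂P, τ ω = 0 := by
  obtain ⟨π', hfeas, -, hD, hcost⟩ := h.exists_outcome
  have hae := M.ae_eq_of_infoGain_nonpos hfeas.1 ((hπ.infoGain_le hfeas).trans h0.le)
  have hU : ∫ q, (M.uhat q - M.uhat q₀) ∂(π' : Measure (Belief X)) = 0 :=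
    integral_eq_zero_of_ae (hae.mono fun q hq => by simp [hq])
  rw [hU] at hcost
  have hD0 : ∫⁻ ω, ((τ ω).untopA : ℝ≥0∞) ∂P = 0 := by
    have : (∫⁻ ω, ((τ ω).untopA : ℝ≥0∞) ∂P).toReal ≤ 0 :=
      nonpos_of_mul_nonpos_right hcost M.κ_pos
    exact ((ENNReal.toReal_eq_zero_iff _).1 (le_antisymm this ENNReal.toReal_nonneg)).resolve_right
      hD
  rw [lintegral_eq_zero_iff h.1.stopping.1.measurable'.untopA.coe_nnreal_ennreal] at hD0
  -- `untopA` sends `⊤` to an arbitrary value, so almost sure finiteness is needed to conclude `τ =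
  -- 0`.
  filter_upwards [hD0, h.1.stopping.2] with ω hω hfin
  have hω' : (τ ω).untopA = 0 := by simpa using hω
  rw [← WithTop.coe_untop (τ ω) hfin, ← WithTop.untopA_eq_untop hfin, hω']
  rfl

end Policies

end Engagement

/-! ### The natural filtration and the first jump as a stopping time. -/

namespace Engagement

section Filtration

set_option linter.unusedSectionVars false

variable {X : Type*} [Fintype X]

/-- Membership in an event of the natural filtration at time `t` depends only on the path up to
time `t`. -/
lemma mem_iff_of_forall_le {t : ℝ≥0} {S : Set (PathSpace X)}
    (hS : MeasurableSet[naturalFiltration X t] S) {ω ω' : PathSpace X}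
    (h : ∀ s ≤ t, belief s ω = belief s ω') : ω ∈ S ↔ ω' ∈ S := by
  unfold naturalFiltration at hS
  rw [Filtration.natural_eq_comap] at hS
  obtain ⟨B, -, rfl⟩ := hS
  have : (fun j : Set.Iic t => belief (j : ℝ≥0) ω) = fun j : Set.Iic t => belief (j : ℝ≥0) ω' :=
    funext fun j => h j j.2
  simp only [Set.mem_preimage, this]

/-- Galmarino's test. -/
lemma stoppingTime_eq_of_forall_le {τ : PathSpace X → WithTop ℝ≥0}
    (hτ : IsStoppingTime (naturalFiltration X) τ) {ω ω' : PathSpace X} {t : ℝ≥0}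
    (ht : τ ω = t) (h : ∀ s ≤ t, belief s ω = belief s ω') : τ ω' = t := by
  have h1 : τ ω' ≤ t := (mem_iff_of_forall_le (hτ t) h).1 ht.le
  refine le_antisymm h1 ?_
  lift τ ω' to ℝ≥0 using ne_top_of_le_ne_top WithTop.coe_ne_top h1 with s hs
  have h2 : s ≤ t := WithTop.coe_le_coe.1 h1
  have h3 : τ ω ≤ s := (mem_iff_of_forall_le (hτ s) fun r hr => h r (hr.trans h2)).2 hs.ge
  rwa [ht] at h3

lemma stronglyMeasurable_belief {s t : ℝ≥0} (h : s ≤ t) :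
    StronglyMeasurable[naturalFiltration X t] (belief s : PathSpace X → Belief X) :=
  (Filtration.stronglyAdapted_natural fun t =>
    (measurable_belief t).stronglyMeasurable).stronglyMeasurable_le h

lemma measurable_belief_of_le {s t : ℝ≥0} (h : s ≤ t) :
    Measurable[naturalFiltration X t] (belief s : PathSpace X → Belief X) :=
  (stronglyMeasurable_belief h).measurable

/-- The path leaves its initial value by a jump at time `s`. -/
def JumpsAt (ω : PathSpace X) (s : ℝ≥0) : Prop :=
  (∀ r < s, belief r ω = belief 0 ω) ∧ belief s ω ≠ belief 0 ω

lemma JumpsAt.unique {ω : PathSpace X} {s s' : ℝ≥0} (h : JumpsAt ω s) (h' : JumpsAt ω s') :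
    s = s' := by
  rcases lt_trichotomy s s' with hlt | heq | hlt
  · exact absurd (h'.1 s hlt) h.2
  · exact heq
  · exact absurd (h.1 s' hlt) h'.2

lemma JumpsAt.jumpTime_eq {ω : PathSpace X} {s : ℝ≥0} (h : JumpsAt ω s) : jumpTime ω = s := by
  refine le_antisymm (sInf_le ⟨s, h.2, rfl⟩) (le_sInf ?_)
  rintro _ ⟨r, hr, rfl⟩
  rw [WithTop.coe_le_coe]
  by_contra! hlt
  exact hr (h.1 r hlt)

open scoped Classical in
/-- The time at which the path jumps away from its initial value, and `⊤` for paths that never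
leave it or leave it continuously. -/
noncomputable def firstJump (ω : PathSpace X) : WithTop ℝ≥0 :=
  if h : ∃ s, JumpsAt ω s then (h.choose : WithTop ℝ≥0) else ⊤

lemma JumpsAt.firstJump_eq {ω : PathSpace X} {s : ℝ≥0} (h : JumpsAt ω s) : firstJump ω = s := by
  have hex : ∃ s, JumpsAt ω s := ⟨s, h⟩
  rw [firstJump, dif_pos hex, hex.choose_spec.unique h]

lemma exists_jumpsAt {ω : PathSpace X} (h : firstJump ω ≠ ⊤) : ∃ s, JumpsAt ω s := by
  by_contra hex
  exact h (dif_neg hex)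

lemma firstJump_le_iff {ω : PathSpace X} {t : ℝ≥0} :
    firstJump ω ≤ t ↔ ∃ s ≤ t, JumpsAt ω s := by
  constructor
  · intro h
    obtain ⟨s, hs⟩ := exists_jumpsAt (ne_top_of_le_ne_top WithTop.coe_ne_top h)
    rw [hs.firstJump_eq, WithTop.coe_le_coe] at h
    exact ⟨s, h, hs⟩
  · rintro ⟨s, hst, hs⟩
    rw [hs.firstJump_eq, WithTop.coe_le_coe]
    exact hst

lemma continuousWithinAt_belief (ω : PathSpace X) (t : ℝ≥0) :
    ContinuousWithinAt (fun s => belief s ω) (Set.Ici t) t := (ω.2 t).1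

/-- A property of beliefs that is open and holds at time `s` holds on an interval after `s`. -/
lemma exists_forall_Ico {ω : PathSpace X} {s : ℝ≥0} {U : Set (Belief X)} (hU : IsOpen U)
    (hs : belief s ω ∈ U) : ∃ v > s, ∀ r, s ≤ r → r < v → belief r ω ∈ U := by
  have h := continuousWithinAt_belief ω s (hU.mem_nhds hs)
  obtain ⟨v, hv, hsub⟩ := (mem_nhdsGE_iff_exists_Ico_subset).1 h
  exact ⟨v, hv, fun r h1 h2 => hsub ⟨h1, h2⟩⟩

lemma exists_denseSeq_mem_Ioo {a b : ℝ≥0} (h : a < b) :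
    ∃ k, a < TopologicalSpace.denseSeq ℝ≥0 k ∧ TopologicalSpace.denseSeq ℝ≥0 k < b := by
  obtain ⟨k, hk⟩ := (TopologicalSpace.denseRange_denseSeq ℝ≥0).exists_mem_open isOpen_Ioo
    (Set.nonempty_Ioo.2 h)
  exact ⟨k, hk⟩

/-- Having jumped by time `t` is a condition on the path at countably many times up to `t`. -/
lemma exists_jumpsAt_le_iff {ω : PathSpace X} {t : ℝ≥0} (c : ℕ → ℝ≥0)
    (hc : ∀ a b, a < b → ∃ k, a < c k ∧ c k < b) :
    (∃ s ≤ t, JumpsAt ω s) ↔ ∃ n : ℕ, ∀ m : ℕ, ∃ k : ℕ,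
      (∀ j : ℕ, min (c j) t + 1 / (m + 1) ≤ min (c k) t →
        belief (min (c j) t) ω = belief 0 ω) ∧
      1 / ((n : ℝ) + 1) < dist (belief (min (c k) t) ω) (belief 0 ω) := by
  constructor
  -- The jump size gives `n`, and right continuity keeps the path that far from its start just after
  -- `s`. Given `m`, `c k` is taken so soon after `s` that dates `1 / (m + 1)` earlier precede `s`.
  · rintro ⟨s, hst, hs⟩
    obtain ⟨n, hn⟩ := exists_nat_one_div_lt (dist_pos.2 hs.2)
    obtain ⟨v, hv, hsub⟩ := exists_forall_Ico
      (U := {q | 1 / ((n : ℝ) + 1) < dist q (belief 0 ω)})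
      (isOpen_lt continuous_const (continuous_id.dist continuous_const)) hn
    refine ⟨n, fun m => ?_⟩
    obtain ⟨k, hk1, hk2⟩ := hc s (min v (s + 1 / ((m : ℝ≥0) + 1)))
      (lt_min hv (lt_add_of_pos_right _ (by positivity)))
    refine ⟨k, fun j hj => hs.1 _ ?_, hsub _ (le_min hk1.le hst)
      ((min_le_left _ _).trans_lt (hk2.trans_le (min_le_left _ _)))⟩
    have : min (c j) t + 1 / ((m : ℝ≥0) + 1) < s + 1 / (m + 1) :=
      hj.trans_lt ((min_le_left _ _).trans_lt (hk2.trans_le (min_le_right _ _)))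
    exact lt_of_add_lt_add_right this
  · rintro ⟨n, hn⟩
    choose k hk1 hk2 using hn
    let J : Set ℝ≥0 := {x | belief x ω ≠ belief 0 ω}
    have hkJ : ∀ m, min (c (k m)) t ∈ J := fun m heq => by
      have h1 := hk2 m
      rw [heq, dist_self] at h1
      exact absurd h1 (not_lt.2 (by positivity))
    -- The exit time from the initial value. The witnesses converge to it from the right, and the
    -- distance `1 / (n + 1)`, fixed before `m`, survives in the limit: the exit is a jump.
    let s := sInf J
    have hsle : ∀ x ∈ J, s ≤ x := fun x hx => csInf_le (OrderBot.bddBelow J) hx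
    have hlt : ∀ m, min (c (k m)) t ≤ s + 1 / ((m : ℝ≥0) + 1) := by
      intro m
      -- Otherwise the path is off its start at some `x` more than `1 / (m + 1)` before the witness,
      -- hence on an interval after `x`, which contains some `c j`.
      by_contra! hcon
      have h1 : s < min (c (k m)) t - 1 / ((m : ℝ≥0) + 1) := lt_tsub_iff_right.2 hcon
      obtain ⟨x, hxJ, hx⟩ := exists_lt_of_csInf_lt ⟨_, hkJ m⟩ h1
      obtain ⟨v, hv, hsub⟩ := exists_forall_Ico (U := {belief 0 ω}ᶜ)
        isClosed_singleton.isOpen_compl hxJ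
      obtain ⟨j, hj1, hj2⟩ := hc x _ (lt_min hv hx)
      have hj3 : c j + 1 / ((m : ℝ≥0) + 1) < min (c (k m)) t :=
        lt_tsub_iff_right.1 (hj2.trans_le (min_le_right _ _))
      have hjt : min (c j) t = c j :=
        min_eq_left ((le_self_add.trans hj3.le).trans (min_le_right _ _))
      refine hsub (c j) hj1.le (hj2.trans_le (min_le_left _ _)) ?_
      have := hk1 m j (by rw [hjt]; exact hj3.le)
      rwa [hjt] at this
    have hlim : Tendsto (fun m => min (c (k m)) t) atTop (𝓝[Set.Ici s] s) := by
      refine tendsto_nhdsWithin_iff.2 ⟨?_, Eventually.of_forall fun m => hsle _ (hkJ m)⟩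
      refine tendsto_of_tendsto_of_tendsto_of_le_of_le tendsto_const_nhds ?_
        (fun m => hsle _ (hkJ m)) hlt
      simpa using tendsto_const_nhds.add tendsto_one_div_add_one_nnreal
    refine ⟨s, (hsle _ (hkJ 0)).trans (min_le_right _ _), fun r hr => ?_, ?_⟩
    · by_contra hne
      exact absurd (hsle r hne) (not_le.2 hr)
    · have h1 : Tendsto (fun m => dist (belief (min (c (k m)) t) ω) (belief 0 ω)) atTop
          (𝓝 (dist (belief s ω) (belief 0 ω))) :=
        ((continuousWithinAt_belief ω s).tendsto.comp hlim).dist tendsto_const_nhds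
      have h2 : 1 / ((n : ℝ) + 1) ≤ dist (belief s ω) (belief 0 ω) :=
        ge_of_tendsto' h1 fun m => (hk2 m).le
      exact dist_pos.1 (lt_of_lt_of_le (by positivity) h2)

/-- `jumpTime` need not be a stopping time of this raw filtration: a path that leaves continuously
at `t` looks constant up to `t`. Requiring a jump makes the exit visible at `t` through countably
many dates. -/
lemma isStoppingTime_firstJump : IsStoppingTime (naturalFiltration X) (firstJump (X := X)) := by
  intro t
  have hb : ∀ j, Measurable[naturalFiltration X t]
      (belief (min (TopologicalSpace.denseSeq ℝ≥0 j) t) : PathSpace X → Belief X) :=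
    fun j => measurable_belief_of_le (min_le_right _ _)
  have hb0 : Measurable[naturalFiltration X t] (belief 0 : PathSpace X → Belief X) :=
    measurable_belief_of_le zero_le
  simp only [firstJump_le_iff, exists_jumpsAt_le_iff (TopologicalSpace.denseSeq ℝ≥0)
    (fun a b h => exists_denseSeq_mem_Ioo h), Set.ofPred_exists, Set.ofPred_forall, Set.ofPred_and]
  refine MeasurableSet.iUnion fun n => MeasurableSet.iInter fun m => MeasurableSet.iUnion fun k =>
    (MeasurableSet.iInter fun j => MeasurableSet.iInter fun _ => ?_).inter ?_
  · exact measurableSet_eq_fun (hb j) hb0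
  · have hd : Measurable[naturalFiltration X t] fun ω : PathSpace X =>
        dist (belief (min (TopologicalSpace.denseSeq ℝ≥0 k) t) ω) (belief 0 ω) :=
      measurable_dist.comp ((hb k).prodMk hb0)
    exact hd measurableSet_Ioi

end Filtration

end Engagement

/-! ### Truncated means of the exponential distribution. -/

section Exponential

/-- The exponential distribution as a measure on `ℝ≥0`. -/
noncomputable def expNNReal (α : ℝ) : Measure ℝ≥0 := (expMeasure α).map Real.toNNReal

variable {α : ℝ}

lemma isProbabilityMeasure_expNNReal (hα : 0 < α) : IsProbabilityMeasure (expNNReal α) := by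
  have := isProbabilityMeasure_expMeasure hα
  exact Measure.isProbabilityMeasure_map measurable_real_toNNReal.aemeasurable

lemma expNNReal_real_Iic (hα : 0 < α) (t : ℝ≥0) :
    (expNNReal α).real (Set.Iic t) = 1 - Real.exp (-(α * t)) := by
  have := isProbabilityMeasure_expMeasure hα
  have h := cdf_expMeasure_eq hα (t : ℝ)
  rw [cdf_eq_real, if_pos (NNReal.coe_nonneg t)] at h
  rw [← h, expNNReal, map_measureReal_apply measurable_real_toNNReal measurableSet_Iic]
  congr 1
  ext x
  simp [Real.toNNReal_le_iff_le_coe]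

lemma expNNReal_Ioi (hα : 0 < α) (t : ℝ≥0) :
    expNNReal α (Set.Ioi t) = ENNReal.ofReal (Real.exp (-(α * t))) := by
  have := isProbabilityMeasure_expNNReal hα
  rw [← ofReal_measureReal, ← Set.compl_Iic, probReal_compl_eq_one_sub measurableSet_Iic,
    expNNReal_real_Iic hα]
  simp

lemma ae_pos_expNNReal (hα : 0 < α) : ∀ᵐ e ∂(expNNReal α), 0 < e := by
  have := isProbabilityMeasure_expNNReal hα
  have h := expNNReal_real_Iic hα 0
  simp only [NNReal.coe_zero, mul_zero, neg_zero, Real.exp_zero, sub_self] at h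
  rw [measureReal_eq_zero_iff] at h
  have : ∀ᵐ e ∂(expNNReal α), e ∉ Set.Iic 0 := measure_eq_zero_iff_ae_notMem.1 h
  filter_upwards [this] with e he
  simpa [pos_iff_ne_zero] using he

/-- Layer cake: the tail of `min t e` is `exp (-α u)` for `u < t` and zero beyond, so its mean is
the integral of that exponential over `[0, t]`. This proportionality to the distribution function is
what balances information against time. -/
lemma lintegral_min_expNNReal (hα : 0 < α) (t : ℝ≥0) :
    ∫⁻ e, (min t e : ℝ≥0) ∂(expNNReal α) =
      ENNReal.ofReal ((expNNReal α).real (Set.Iic t) / α) := by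
  have h1 : ∫⁻ e, (min t e : ℝ≥0) ∂(expNNReal α) =
      ∫⁻ e, ENNReal.ofReal ((min t e : ℝ≥0) : ℝ) ∂(expNNReal α) := by
    simp only [ENNReal.ofReal_coe_nnreal]
  rw [h1, lintegral_eq_lintegral_meas_lt _ (Eventually.of_forall fun e => NNReal.coe_nonneg _)
    (by fun_prop)]
  have h2 : ∀ u ∈ Set.Ioi (0 : ℝ),
      expNNReal α {e | u < ((min t e : ℝ≥0) : ℝ)} =
        (Set.Iio (t : ℝ)).indicator (fun u => ENNReal.ofReal (Real.exp (-(α * u)))) u := by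
    intro u hu
    lift u to ℝ≥0 using le_of_lt hu
    simp only [NNReal.coe_lt_coe, lt_min_iff]
    by_cases hut : u < t
    · rw [Set.indicator_of_mem (by simpa using hut), ← expNNReal_Ioi hα]
      simp [hut, Set.Ioi]
    · rw [Set.indicator_of_notMem (by simpa using hut)]
      simp [hut]
  rw [setLIntegral_congr_fun measurableSet_Ioi h2, setLIntegral_indicator measurableSet_Iio,
    Set.inter_comm, Set.Ioi_inter_Iio, expNNReal_real_Iic hα,
    Measure.restrict_congr_set Ioo_ae_eq_Ioc,
    ← ofReal_integral_eq_lintegral_ofReal (exp_neg_integrableOn_Ioc hα)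
      (Eventually.of_forall fun u => (Real.exp_pos _).le),
    ← intervalIntegral.integral_of_le (NNReal.coe_nonneg t)]
  congr 1
  have hderiv : ∀ u ∈ Set.uIcc (0 : ℝ) t, HasDerivAt (fun u => -Real.exp (-(α * u)) / α)
      (Real.exp (-(α * u))) u := fun u _ => by
    have h := (hasDerivAt_neg_exp_mul_exp (r := α) (x := u)).div_const α
    rwa [mul_div_cancel_left₀ _ hα.ne'] at h
  rw [intervalIntegral.integral_eq_sub_of_hasDerivAt hderiv
    (Continuous.intervalIntegrable (by fun_prop) _ _)]
  simp only [mul_zero, neg_zero, Real.exp_zero]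
  ring

lemma lintegral_expNNReal (hα : 0 < α) :
    ∫⁻ e, (e : ℝ≥0∞) ∂(expNNReal α) = ENNReal.ofReal (1 / α) := by
  have := isProbabilityMeasure_expNNReal hα
  have h1 : Tendsto (fun N : ℕ => ∫⁻ e, (min (N : ℝ≥0) e : ℝ≥0) ∂(expNNReal α)) atTop
      (𝓝 (∫⁻ e, (e : ℝ≥0∞) ∂(expNNReal α))) := by
    refine lintegral_tendsto_of_tendsto_of_monotone (fun N => by fun_prop)
      (Eventually.of_forall fun e N N' h => ?_) (Eventually.of_forall fun e => ?_)
    · exact ENNReal.coe_le_coe.2 (min_le_min (by exact_mod_cast h) le_rfl)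
    · refine tendsto_const_nhds.congr' ?_
      filter_upwards [eventually_ge_atTop ⌈e⌉₊] with N hN
      rw [min_eq_right ((Nat.le_ceil e).trans (by exact_mod_cast hN))]
  simp only [lintegral_min_expNNReal hα, expNNReal_real_Iic hα] at h1
  refine tendsto_nhds_unique h1 ((ENNReal.continuous_ofReal.tendsto _).comp ?_)
  refine Tendsto.div_const ?_ _
  have h2 : Tendsto (fun N : ℕ => -(α * ((N : ℝ≥0) : ℝ))) atTop atBot :=
    tendsto_neg_atTop_atBot.comp (Tendsto.const_mul_atTop hα (by
      simpa using tendsto_natCast_atTop_atTop (R := ℝ)))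
  simpa using (Real.tendsto_exp_atBot.comp h2).const_sub 1

lemma integral_min_expNNReal (hα : 0 < α) (t : ℝ≥0) :
    ∫ e, ((min t e : ℝ≥0) : ℝ) ∂(expNNReal α) = (expNNReal α).real (Set.Iic t) / α := by
  rw [integral_eq_lintegral_of_nonneg_ae (Eventually.of_forall fun e => NNReal.coe_nonneg _)
    (by fun_prop)]
  simp only [ENNReal.ofReal_coe_nnreal]
  rw [lintegral_min_expNNReal hα, ENNReal.toReal_ofReal (by positivity)]

end Exponential

/-! ### The dilution as a policy. -/

namespace Engagement

section Dilution

set_option linter.unusedSectionVars false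

variable {X A : Type*} [Fintype X] [Fintype A] [Nonempty A] {M : Environment X A} {q₀ : Belief X}
  {π : ProbabilityMeasure (Belief X)} {α : ℝ}

/-- The path that stays at `q` forever. -/
def constPath (q : Belief X) : PathSpace X :=
  ⟨fun _ => q, fun _ => ⟨continuousWithinAt_const, q, tendsto_const_nhds⟩⟩

/-- The path that jumps from `q₀` to `p.2` at time `p.1`. -/
noncomputable def jumpPath (q₀ : Belief X) (p : ℝ≥0 × Belief X) : PathSpace X :=
  dilutionPath q₀ (p.2, fun _ => p.1)

lemma belief_dilutionPath_of_le {z : Belief X × (ℕ → ℝ≥0)} {t : ℝ≥0} (h : z.2 0 ≤ t) :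
    belief t (dilutionPath q₀ z) = z.1 := by
  change dilutionFun q₀ z.1 z.2 t = z.1
  simp [dilutionFun, one_le_arrivalCount_iff, h]

lemma belief_dilutionPath_of_lt {z : Belief X × (ℕ → ℝ≥0)} {t : ℝ≥0} (h : t < z.2 0) :
    belief t (dilutionPath q₀ z) = q₀ := by
  change dilutionFun q₀ z.1 z.2 t = q₀
  simp [dilutionFun, one_le_arrivalCount_iff, not_le.2 h]

lemma belief_jumpPath_of_le {p : ℝ≥0 × Belief X} {t : ℝ≥0} (h : p.1 ≤ t) :
    belief t (jumpPath q₀ p) = p.2 := belief_dilutionPath_of_le (z := (p.2, fun _ => p.1)) h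

lemma belief_jumpPath_of_lt {p : ℝ≥0 × Belief X} {t : ℝ≥0} (h : t < p.1) :
    belief t (jumpPath q₀ p) = q₀ := belief_dilutionPath_of_lt (z := (p.2, fun _ => p.1)) h

lemma dilutionPath_eq_jumpPath (z : Belief X × (ℕ → ℝ≥0)) :
    dilutionPath q₀ z = jumpPath q₀ (z.2 0, z.1) := by
  refine Subtype.ext (funext fun t => ?_)
  change belief t _ = belief t _
  rcases le_or_gt (z.2 0) t with h | h
  · rw [belief_dilutionPath_of_le h, belief_jumpPath_of_le h]
  · rw [belief_dilutionPath_of_lt h, belief_jumpPath_of_lt h]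

lemma measurable_jumpPath (q₀ : Belief X) : Measurable (jumpPath q₀) := by
  refine (measurable_pi_iff.2 fun t => ?_).subtype_mk
  have : (fun p : ℝ≥0 × Belief X => belief t (jumpPath q₀ p)) =
      fun p => if p.1 ≤ t then p.2 else q₀ := by
    ext1 p
    split_ifs with h
    · exact belief_jumpPath_of_le h
    · exact belief_jumpPath_of_lt (not_le.1 h)
  change Measurable fun p : ℝ≥0 × Belief X => belief t (jumpPath q₀ p)
  rw [this]
  exact Measurable.ite (measurableSet_le measurable_fst measurable_const) measurable_snd
    measurable_const

/-- Arrivals after the first do not change the path, so only one exponential time and the target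
belief remain. -/
lemma dilutionLaw_eq_map_jumpPath (hα : 0 < α) (q₀ : Belief X)
    (π : ProbabilityMeasure (Belief X)) :
    dilutionLaw q₀ π α =
      ((expNNReal α).prod (π : Measure (Belief X))).map (jumpPath q₀) := by
  have := isProbabilityMeasure_expNNReal hα
  have hpath : dilutionPath q₀ = jumpPath q₀ ∘ Prod.swap ∘
      Prod.map (id : Belief X → Belief X) (Function.eval (0 : ℕ) : (ℕ → ℝ≥0) → ℝ≥0) :=
    funext fun z => dilutionPath_eq_jumpPath z
  have hmap : Measurable (Prod.map (id : Belief X → Belief X)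
      (Function.eval (0 : ℕ) : (ℕ → ℝ≥0) → ℝ≥0)) :=
    measurable_id.prodMap (measurable_pi_apply 0)
  have : IsProbabilityMeasure ((expMeasure α).map Real.toNNReal) := this
  unfold dilutionLaw
  rw [hpath, ← Measure.map_map (measurable_jumpPath q₀) (measurable_swap.comp hmap),
    ← Measure.map_map measurable_swap hmap,
    ← Measure.map_prod_map _ _ measurable_id (measurable_pi_apply 0), Measure.map_id]
  have h0 := (measurePreserving_eval_infinitePi
    (fun _ : ℕ => (expMeasure α).map Real.toNNReal) 0).map_eq
  rw [h0, Measure.prod_swap]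
  rfl

lemma isProbabilityMeasure_dilutionLaw (hα : 0 < α) :
    IsProbabilityMeasure (dilutionLaw q₀ π α) := by
  have := isProbabilityMeasure_expNNReal hα
  rw [dilutionLaw_eq_map_jumpPath hα]
  exact Measure.isProbabilityMeasure_map (measurable_jumpPath q₀).aemeasurable

lemma integral_dilutionLaw (hα : 0 < α) {E : Type*} [NormedAddCommGroup E] [NormedSpace ℝ E]
    {f : PathSpace X → E} (hf : AEStronglyMeasurable f (dilutionLaw q₀ π α)) :
    ∫ ω, f ω ∂(dilutionLaw q₀ π α) =
      ∫ p, f (jumpPath q₀ p) ∂((expNNReal α).prod (π : Measure (Belief X))) := by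
  rw [dilutionLaw_eq_map_jumpPath hα] at hf ⊢
  exact integral_map (measurable_jumpPath q₀).aemeasurable hf

lemma lintegral_dilutionLaw (hα : 0 < α) {f : PathSpace X → ℝ≥0∞} (hf : Measurable f) :
    ∫⁻ ω, f ω ∂(dilutionLaw q₀ π α) =
      ∫⁻ p, f (jumpPath q₀ p) ∂((expNNReal α).prod (π : Measure (Belief X))) := by
  rw [dilutionLaw_eq_map_jumpPath hα, lintegral_map hf (measurable_jumpPath q₀)]

lemma ae_jumpPath (hα : 0 < α) {p : PathSpace X → Prop} (h : ∀ᵐ ω ∂(dilutionLaw q₀ π α), p ω) :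
    ∀ᵐ z ∂((expNNReal α).prod (π : Measure (Belief X))), p (jumpPath q₀ z) := by
  rw [dilutionLaw_eq_map_jumpPath hα] at h
  exact ae_of_ae_map (measurable_jumpPath q₀).aemeasurable h

lemma ae_dilutionLaw (hα : 0 < α) {p : PathSpace X → Prop} (hp : MeasurableSet {ω | p ω})
    (h : ∀ᵐ z ∂((expNNReal α).prod (π : Measure (Belief X))), p (jumpPath q₀ z)) :
    ∀ᵐ ω ∂(dilutionLaw q₀ π α), p ω := by
  rw [dilutionLaw_eq_map_jumpPath hα]
  exact (ae_map_iff (measurable_jumpPath q₀).aemeasurable hp).2 h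

/-- Until the jump, events of the natural filtration carry no information. -/
lemma condExp_dilutionLaw_eq_zero (hα : 0 < α) {E : Type*} [NormedAddCommGroup E]
    [NormedSpace ℝ E] [CompleteSpace E] {f : PathSpace X → E}
    (hf : Integrable f (dilutionLaw q₀ π α)) {s : ℝ≥0}
    (h0 : ∀ᵐ p ∂((expNNReal α).prod (π : Measure (Belief X))),
      p.1 ≤ s → f (jumpPath q₀ p) = 0)
    (h1 : ∫ p, f (jumpPath q₀ p) ∂((expNNReal α).prod (π : Measure (Belief X))) = 0) :
    (dilutionLaw q₀ π α)[f | naturalFiltration X s] =ᵐ[dilutionLaw q₀ π α] 0 := by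
  have := isProbabilityMeasure_dilutionLaw (q₀ := q₀) (π := π) hα
  refine (ae_eq_condExp_of_forall_setIntegral_eq ((naturalFiltration X).le s) hf
    (fun _ _ _ => integrableOn_zero) (fun S hS _ => ?_) aestronglyMeasurable_zero).symm
  have hS' : MeasurableSet S := (naturalFiltration X).le s S hS
  have hpre : MeasurableSet (jumpPath q₀ ⁻¹' S) := measurable_jumpPath q₀ hS'
  have hagree : ∀ p : ℝ≥0 × Belief X, s < p.1 → (jumpPath q₀ p ∈ S ↔ constPath q₀ ∈ S) :=
    fun p hp => mem_iff_of_forall_le hS fun r hr => belief_jumpPath_of_lt (hr.trans_lt hp)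
  simp only [integral_zero]
  rw [dilutionLaw_eq_map_jumpPath hα] at hf ⊢
  rw [setIntegral_map hS' hf.aestronglyMeasurable (measurable_jumpPath q₀).aemeasurable]
  -- An event known at `s` contains all paths that have not jumped by `s`, or none of them. On the
  -- others `f` vanishes, so the integral over the event is the total integral or zero.
  by_cases hc : constPath q₀ ∈ S
  · rw [setIntegral_eq_integral_of_ae_compl_eq_zero, h1]
    filter_upwards [h0] with p hp hpS
    refine hp (not_lt.1 fun hlt => hpS ((hagree p hlt).2 hc))
  · symm
    refine integral_eq_zero_of_ae ((ae_restrict_iff' hpre).2 ?_)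
    filter_upwards [h0] with p hp hpS
    exact hp (not_lt.1 fun hlt => hc ((hagree p hlt).1 hpS))

lemma integral_ite_le (hα : 0 < α) {E : Type*} [NormedAddCommGroup E] [NormedSpace ℝ E]
    (g : Belief X → E) (t : ℝ≥0) :
    ∫ p, (if p.1 ≤ t then g p.2 else 0) ∂((expNNReal α).prod (π : Measure (Belief X))) =
      (expNNReal α).real (Set.Iic t) • ∫ q, g q ∂(π : Measure (Belief X)) := by
  have := isProbabilityMeasure_expNNReal hα
  rw [← integral_indicator_one measurableSet_Iic, ← integral_prod_smul]
  refine integral_congr_ae (Eventually.of_forall fun p => ?_)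
  by_cases h : p.1 ≤ t <;> simp [h]

lemma integrable_ite_le (hα : 0 < α) {E : Type*} [NormedAddCommGroup E] [NormedSpace ℝ E]
    {g : Belief X → E} (hg : Integrable g (π : Measure (Belief X))) (t : ℝ≥0) :
    Integrable (fun p : ℝ≥0 × Belief X => if p.1 ≤ t then g p.2 else 0)
      ((expNNReal α).prod (π : Measure (Belief X))) := by
  have := isProbabilityMeasure_expNNReal hα
  have h1 : Integrable ((Set.Iic t).indicator (1 : ℝ≥0 → ℝ)) (expNNReal α) :=
    (integrable_const 1).indicator measurableSet_Iic
  refine (h1.smul_prod hg).congr (Eventually.of_forall fun p => ?_)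
  by_cases h : p.1 ≤ t <;> simp [h]

/-- The increments of a function of the belief along a dilution. -/
lemma sub_jumpPath {E : Type*} [AddCommGroup E] (f : Belief X → E) (s t : ℝ≥0)
    (p : ℝ≥0 × Belief X) :
    f (belief t (jumpPath q₀ p)) - f (belief s (jumpPath q₀ p)) =
      (if p.1 ≤ t then f p.2 - f q₀ else 0) - (if p.1 ≤ s then f p.2 - f q₀ else 0) := by
  have key : ∀ t, f (belief t (jumpPath q₀ p)) = (if p.1 ≤ t then f p.2 - f q₀ else 0) + f q₀ := by
    intro t
    split_ifs with h
    · rw [belief_jumpPath_of_le h, sub_add_cancel]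
    · rw [belief_jumpPath_of_lt (not_le.1 h), zero_add]
  rw [key, key, add_sub_add_right_eq_sub]

/-- Increments after `s` vanish if the jump came by `s`, and have total mean zero because `π` has
mean `q₀`; `condExp_dilutionLaw_eq_zero` does the rest. -/
theorem martingale_dilutionLaw (hα : 0 < α)
    (hmean : ∀ x, ∫ q, q x ∂(π : Measure (Belief X)) = q₀ x) :
    Martingale (fun t ω => (belief t ω : X → ℝ)) (naturalFiltration X) (dilutionLaw q₀ π α) := by
  have := isProbabilityMeasure_dilutionLaw (q₀ := q₀) (π := π) hα
  have hcont : Continuous fun q : Belief X => (q : X → ℝ) := continuous_subtype_val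
  have hint : ∀ t, Integrable (fun ω => (belief t ω : X → ℝ)) (dilutionLaw q₀ π α) :=
    fun t => integrable_continuous_comp (measurable_belief t) hcont
  have hsm : ∀ t, StronglyMeasurable[naturalFiltration X t]
      fun ω : PathSpace X => (belief t ω : X → ℝ) :=
    fun t => hcont.comp_stronglyMeasurable (stronglyMeasurable_belief le_rfl)
  refine ⟨hsm, fun s t hst => ?_⟩
  have hg : Integrable (fun q : Belief X => (q : X → ℝ) - (q₀ : X → ℝ)) (π : Measure (Belief X)) :=
    integrable_of_continuous (hcont.sub continuous_const) _
  have hg0 : ∫ q, ((q : X → ℝ) - (q₀ : X → ℝ)) ∂(π : Measure (Belief X)) = 0 := by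
    rw [integral_sub (integrable_of_continuous hcont _) (integrable_const _),
      integral_coe_eq_of_mean hmean]
    simp
  have hzero := condExp_dilutionLaw_eq_zero hα (s := s) ((hint t).sub (hint s))
    (Eventually.of_forall fun p hp => by
      simp [belief_jumpPath_of_le hp, belief_jumpPath_of_le (hp.trans hst)])
    (by
      simp only [Pi.sub_apply]
      simp only [sub_jumpPath (fun q : Belief X => (q : X → ℝ))]
      rw [integral_sub (integrable_ite_le hα hg t) (integrable_ite_le hα hg s),
        integral_ite_le hα (fun q : Belief X => (q : X → ℝ) - (q₀ : X → ℝ)),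
        integral_ite_le hα (fun q : Belief X => (q : X → ℝ) - (q₀ : X → ℝ)), hg0]
      simp)
  have hsub := condExp_sub (hint t) (hint s) (naturalFiltration X s)
  rw [condExp_of_stronglyMeasurable ((naturalFiltration X).le s) (hsm s) (hint s)] at hsub
  filter_upwards [hzero, hsub] with ω h1 h2
  rw [h1] at h2
  exact (sub_eq_zero.1 h2.symm)

lemma jumpsAt_jumpPath {p : ℝ≥0 × Belief X} (hp : 0 < p.1) (hq : p.2 ≠ q₀) :
    JumpsAt (jumpPath q₀ p) p.1 := by
  have h0 : belief 0 (jumpPath q₀ p) = q₀ := belief_jumpPath_of_lt hp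
  refine ⟨fun r hr => by rw [h0, belief_jumpPath_of_lt hr], ?_⟩
  rw [h0, belief_jumpPath_of_le le_rfl]
  exact hq

/-- Almost surely the dilution jumps away from the prior exactly at its first arrival. -/
lemma ae_firstJump_jumpPath (hα : 0 < α) (hne : ∀ᵐ q ∂(π : Measure (Belief X)), q ≠ q₀) :
    ∀ᵐ p ∂((expNNReal α).prod (π : Measure (Belief X))),
      0 < p.1 ∧ firstJump (jumpPath q₀ p) = p.1 := by
  have := isProbabilityMeasure_expNNReal hα
  filter_upwards [Measure.quasiMeasurePreserving_fst.ae (ae_pos_expNNReal hα),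
    Measure.quasiMeasurePreserving_snd.ae hne] with p h1 h2
  exact ⟨h1, (jumpsAt_jumpPath h1 h2).firstJump_eq⟩

lemma isAdmissibleTime_firstJump (hα : 0 < α)
    (hne : ∀ᵐ q ∂(π : Measure (Belief X)), q ≠ q₀) :
    IsAdmissibleTime (dilutionLaw q₀ π α) (firstJump (X := X)) := by
  refine ⟨isStoppingTime_firstJump, ae_dilutionLaw hα
    isStoppingTime_firstJump.measurableSet_eq_top.compl ?_⟩
  filter_upwards [ae_firstJump_jumpPath (q₀ := q₀) hα hne] with p hp
  rw [hp.2]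
  exact WithTop.coe_ne_top

lemma firstJump_ae_eq_jumpTime (hα : 0 < α)
    (hne : ∀ᵐ q ∂(π : Measure (Belief X)), q ≠ q₀) :
    firstJump =ᵐ[dilutionLaw q₀ π α] jumpTime := by
  filter_upwards [(isAdmissibleTime_firstJump (q₀ := q₀) hα hne).2] with ω hω
  obtain ⟨s, hs⟩ := exists_jumpsAt hω
  rw [hs.firstJump_eq, hs.jumpTime_eq]

lemma lintegral_prod_fst (hα : 0 < α) {f : ℝ≥0 → ℝ≥0∞} (hf : Measurable f) :
    ∫⁻ p, f p.1 ∂((expNNReal α).prod (π : Measure (Belief X))) = ∫⁻ e, f e ∂(expNNReal α) := by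
  have := isProbabilityMeasure_expNNReal hα
  exact (measurePreserving_fst (μ := expNNReal α) (ν := (π : Measure (Belief X)))).lintegral_comp hf

/-- Stopped at its first jump, the dilution accumulates information at the constant rate `χ`. -/
lemma Environment.information_dilutionLaw (hα : 0 < α) (hgain : M.infoGain q₀ π = M.χ / α)
    (hne : ∀ᵐ q ∂(π : Measure (Belief X)), q ≠ q₀) {s t : ℝ≥0} (hst : s ≤ t) :
    (dilutionLaw q₀ π α)[fun ω => M.H (stoppedProcess belief firstJump t ω : Belief X)
        - M.H (stoppedProcess belief firstJump s ω : Belief X) | naturalFiltration X s]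
      =ᵐ[dilutionLaw q₀ π α]
    (dilutionLaw q₀ π α)[fun ω =>
        stoppedProcess (fun (t : ℝ≥0) (_ : PathSpace X) => M.χ * (t : ℝ)) firstJump t ω
        - stoppedProcess (fun (t : ℝ≥0) (_ : PathSpace X) => M.χ * (t : ℝ)) firstJump s ω
        | naturalFiltration X s] := by
  have := isProbabilityMeasure_expNNReal hα
  have := isProbabilityMeasure_dilutionLaw (q₀ := q₀) (π := π) hα
  have hmeas : Measurable (firstJump (X := X)) := isStoppingTime_firstJump.measurable'
  have hint1 : ∀ t, Integrable (fun ω => M.H (stoppedProcess belief firstJump t ω : Belief X))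
      (dilutionLaw q₀ π α) := fun t =>
    integrable_continuous_comp (measurable_stoppedProcess_belief hmeas t) M.continuous_H
  have hint2 : ∀ t, Integrable (stoppedProcess
      (fun (t : ℝ≥0) (_ : PathSpace X) => M.χ * (t : ℝ)) firstJump t) (dilutionLaw q₀ π α) := by
    intro t
    refine Integrable.of_bound (C := M.χ * t) (Measurable.aestronglyMeasurable
      (((measurable_min_const hmeas t).untopA.coe_nnreal_real).const_mul M.χ))
      (Eventually.of_forall fun ω => ?_)
    have hle : ((min (t : WithTop ℝ≥0) (firstJump ω)).untopA : ℝ) ≤ t :=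
      NNReal.coe_le_coe.2 (untopA_min_le t _)
    change ‖M.χ * ((min (t : WithTop ℝ≥0) (firstJump ω)).untopA : ℝ)‖ ≤ _
    rw [Real.norm_of_nonneg (mul_nonneg M.χ_pos.le (NNReal.coe_nonneg _))]
    exact mul_le_mul_of_nonneg_left hle M.χ_pos.le
  have hbelief : ∀ p : ℝ≥0 × Belief X, firstJump (jumpPath q₀ p) = p.1 → ∀ t,
      (stoppedProcess belief firstJump t (jumpPath q₀ p) : Belief X) =
        belief t (jumpPath q₀ p) := by
    intro p hp t
    simp only [stoppedProcess, hp, untopA_min_coe]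
    rcases le_or_gt p.1 t with h | h
    · rw [min_eq_right h, belief_jumpPath_of_le le_rfl, belief_jumpPath_of_le h]
    · rw [min_eq_left h.le]
  have hrate : ∀ p : ℝ≥0 × Belief X, firstJump (jumpPath q₀ p) = p.1 → ∀ t,
      stoppedProcess (fun (t : ℝ≥0) (_ : PathSpace X) => M.χ * (t : ℝ)) firstJump t
        (jumpPath q₀ p) = M.χ * ((min t p.1 : ℝ≥0) : ℝ) := by
    intro p hp t
    simp only [stoppedProcess, hp, untopA_min_coe]
  have hg : Integrable (fun q : Belief X => M.H q - M.H q₀) (π : Measure (Belief X)) :=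
    integrable_of_continuous (M.continuous_H.sub continuous_const) _
  have hmin : ∀ t : ℝ≥0, Integrable (fun p : ℝ≥0 × Belief X => ((min t p.1 : ℝ≥0) : ℝ))
      ((expNNReal α).prod (π : Measure (Belief X))) := fun t =>
    Integrable.of_bound (C := (t : ℝ)) (by fun_prop) (Eventually.of_forall fun p => by
      rw [Real.norm_of_nonneg (NNReal.coe_nonneg _)]
      exact NNReal.coe_le_coe.2 (min_le_left _ _))
  have hmin' : ∀ t : ℝ≥0, ∫ p, ((min t p.1 : ℝ≥0) : ℝ)
      ∂((expNNReal α).prod (π : Measure (Belief X))) = (expNNReal α).real (Set.Iic t) / α :=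
    fun t => by
      rw [integral_fun_fst (fun e => ((min t e : ℝ≥0) : ℝ)), integral_min_expNNReal hα]
      simp
  -- Applied to the difference of the two increments. Its mean is `(F t - F s) * (gain - χ / α)`,
  -- with `F` the exponential distribution function, and this vanishes by the choice of `α`.
  have hzero := condExp_dilutionLaw_eq_zero hα (s := s)
    (((hint1 t).sub (hint1 s)).sub ((hint2 t).sub (hint2 s)))
    (by
      filter_upwards [ae_firstJump_jumpPath (q₀ := q₀) hα hne] with p hp hps
      simp only [Pi.sub_apply, hbelief p hp.2, hrate p hp.2, belief_jumpPath_of_le hps,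
        belief_jumpPath_of_le (hps.trans hst), min_eq_right hps, min_eq_right (hps.trans hst)]
      simp)
    (by
      rw [integral_congr_ae (g := fun p : ℝ≥0 × Belief X =>
        ((if p.1 ≤ t then M.H p.2 - M.H q₀ else 0) - (if p.1 ≤ s then M.H p.2 - M.H q₀ else 0))
        - (M.χ * ((min t p.1 : ℝ≥0) : ℝ) - M.χ * ((min s p.1 : ℝ≥0) : ℝ)))]
      · refine (integral_sub ((integrable_ite_le hα hg t).sub (integrable_ite_le hα hg s))
          (((hmin t).const_mul _).sub ((hmin s).const_mul _))).trans ?_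
        simp only [Pi.sub_apply]
        rw [integral_sub (integrable_ite_le hα hg t) (integrable_ite_le hα hg s),
          integral_sub ((hmin t).const_mul _) ((hmin s).const_mul _),
          integral_const_mul, integral_const_mul, hmin', hmin',
          integral_ite_le hα (fun q : Belief X => M.H q - M.H q₀),
          integral_ite_le hα (fun q : Belief X => M.H q - M.H q₀)]
        change _ • M.infoGain q₀ π - _ • M.infoGain q₀ π - _ = 0
        rw [hgain]
        simp only [smul_eq_mul]
        ring
      · filter_upwards [ae_firstJump_jumpPath (q₀ := q₀) hα hne] with p hp
        simp only [Pi.sub_apply, hbelief p hp.2, hrate p hp.2]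
        rw [sub_jumpPath (fun q : Belief X => M.H q)])
  have hsub := condExp_sub ((hint1 t).sub (hint1 s)) ((hint2 t).sub (hint2 s))
    (naturalFiltration X s)
  filter_upwards [hzero, hsub] with ω h1 h2
  rw [h1] at h2
  exact (sub_eq_zero.1 h2.symm)

theorem Environment.isPolicy_dilutionLaw (hα : 0 < α) (hgain : M.infoGain q₀ π = M.χ / α)
    (hmean : ∀ x, ∫ q, q x ∂(π : Measure (Belief X)) = q₀ x)
    (hne : ∀ᵐ q ∂(π : Measure (Belief X)), q ≠ q₀) :
    M.IsPolicy q₀ (dilutionLaw q₀ π α) (fun t _ => M.χ * (t : ℝ)) firstJump where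
  isProbabilityMeasure := isProbabilityMeasure_dilutionLaw hα
  prior := ae_dilutionLaw hα (measurable_belief 0 (measurableSet_singleton q₀))
    ((ae_firstJump_jumpPath hα hne).mono fun _ hp => belief_jumpPath_of_lt hp.1)
  martingale := martingale_dilutionLaw hα hmean
  adapted := fun _ => measurable_const
  initial := Eventually.of_forall fun _ => by simp
  increasing := Eventually.of_forall fun _ _ _ h =>
    mul_le_mul_of_nonneg_left (NNReal.coe_le_coe.2 h) M.χ_pos.le
  stopping := isAdmissibleTime_firstJump hα hne
  information := fun _ _ hst => M.information_dilutionLaw hα hgain hne hst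
  capacity := Eventually.of_forall fun _ _ _ _ _ => (mul_sub _ _ _).ge

end Dilution

end Engagement

/-! ### Optimality of waiting for the jump, and the no-information policy. -/

namespace Engagement

section Optimality

set_option linter.unusedSectionVars false

variable {X A : Type*} [Fintype X] [Fintype A] [Nonempty A] {M : Environment X A} {q₀ : Belief X}
  {π : ProbabilityMeasure (Belief X)} {α : ℝ}

/-- Only a lower bound on the delay enters, so stopping times of infinite expected delay need no
separate treatment. -/
lemma Environment.agentPayoff_le {P : Measure (PathSpace X)} {τ : PathSpace X → WithTop ℝ≥0}
    {d : ℝ} (hd : 0 ≤ d) (h : ENNReal.ofReal d ≤ ∫⁻ ω, ((τ ω).untopA : ℝ≥0∞) ∂P) :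
    M.agentPayoff P τ ≤
      (((∫ ω, M.uhat (stoppedValue belief τ ω) ∂P) - M.κ * d : ℝ) : EReal) := by
  rw [Environment.agentPayoff, EReal.coe_sub]
  refine EReal.sub_le_sub le_rfl ?_
  have h1 : ((M.κ * d : ℝ) : EReal) = ((ENNReal.ofReal (M.κ * d) : ℝ≥0∞) : EReal) := by
    rw [EReal.coe_ennreal_ofReal, max_eq_left (mul_nonneg M.κ_pos.le hd)]
  rw [h1, EReal.coe_ennreal_le_coe_ennreal_iff, ENNReal.ofReal_mul M.κ_pos.le]
  gcongr

lemma lintegral_firstJump (hα : 0 < α) (hne : ∀ᵐ q ∂(π : Measure (Belief X)), q ≠ q₀) :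
    ∫⁻ ω, ((firstJump ω).untopA : ℝ≥0∞) ∂(dilutionLaw q₀ π α) = ENNReal.ofReal (1 / α) := by
  rw [lintegral_dilutionLaw hα (f := fun ω => ((firstJump ω).untopA : ℝ≥0∞))
      isStoppingTime_firstJump.measurable'.untopA.coe_nnreal_ennreal,
    ← lintegral_expNNReal hα, ← lintegral_prod_fst (π := π) hα (by fun_prop)]
  refine lintegral_congr_ae ?_
  filter_upwards [ae_firstJump_jumpPath (q₀ := q₀) hα hne] with p hp
  simp only [hp.2]
  rfl

lemma Environment.integral_uhat_stoppedValue (hα : 0 < α) {τ : PathSpace X → WithTop ℝ≥0}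
    (hτ : Measurable τ) :
    ∫ ω, M.uhat (stoppedValue belief τ ω) ∂(dilutionLaw q₀ π α) =
      ∫ p, M.uhat (stoppedValue belief τ (jumpPath q₀ p))
        ∂((expNNReal α).prod (π : Measure (Belief X))) :=
  integral_dilutionLaw hα (f := fun ω => M.uhat (stoppedValue belief τ ω))
    (M.continuous_uhat.measurable.comp (measurable_stoppedValue_belief hτ)).aestronglyMeasurable

/-- The agent's payoff from waiting for the dilution to jump. -/
lemma Environment.le_agentPayoff_firstJump (hα : 0 < α)
    (hne : ∀ᵐ q ∂(π : Measure (Belief X)), q ≠ q₀) :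
    (((∫ q, M.uhat q ∂(π : Measure (Belief X))) - M.κ * (1 / α) : ℝ) : EReal) ≤
      M.agentPayoff (dilutionLaw q₀ π α) firstJump := by
  have := isProbabilityMeasure_expNNReal hα
  rw [M.le_agentPayoff_iff, lintegral_firstJump hα hne,
    ENNReal.toReal_ofReal (one_div_pos.2 hα).le,
    M.integral_uhat_stoppedValue hα isStoppingTime_firstJump.measurable']
  refine ⟨ENNReal.ofReal_ne_top, le_of_eq ?_⟩
  congr 1
  have h1 := integral_fun_snd (μ := expNNReal α) (ν := (π : Measure (Belief X))) M.uhat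
  simp only [probReal_univ, one_smul] at h1
  rw [← h1]
  refine integral_congr_ae ?_
  filter_upwards [ae_firstJump_jumpPath (q₀ := q₀) hα hne] with p hp
  have : (stoppedValue belief firstJump (jumpPath q₀ p) : Belief X) = p.2 := by
    simp only [stoppedValue, hp.2]
    exact belief_jumpPath_of_le le_rfl
  rw [this]

/-- A stopping time that does not stop at time `s` on the constant path does not stop at time `s`
before the jump. -/
lemma stoppingTime_constPath_eq {τ : PathSpace X → WithTop ℝ≥0}
    (hτ : IsStoppingTime (naturalFiltration X) τ) {p : ℝ≥0 × Belief X} {s : ℝ≥0}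
    (hs : τ (jumpPath q₀ p) = s) (hlt : s < p.1) : τ (constPath q₀) = s :=
  stoppingTime_eq_of_forall_le hτ hs fun _ hr => belief_jumpPath_of_lt (hr.trans_lt hlt)

lemma stoppingTime_jumpPath_eq {τ : PathSpace X → WithTop ℝ≥0}
    (hτ : IsStoppingTime (naturalFiltration X) τ) {p : ℝ≥0 × Belief X} {s : ℝ≥0}
    (hs : τ (constPath q₀) = s) (hlt : s < p.1) : τ (jumpPath q₀ p) = s :=
  stoppingTime_eq_of_forall_le hτ hs fun _ hr => (belief_jumpPath_of_lt (hr.trans_lt hlt)).symm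

/-- If stopping at the jump is worth its expected delay, no stopping time does better. -/
lemma Environment.agentPayoff_dilutionLaw_le (hα : 0 < α)
    (hworth : M.κ / α ≤ ∫ q, (M.uhat q - M.uhat q₀) ∂(π : Measure (Belief X)))
    {τ : PathSpace X → WithTop ℝ≥0} (hτ : IsAdmissibleTime (dilutionLaw q₀ π α) τ) :
    M.agentPayoff (dilutionLaw q₀ π α) τ ≤
      (((∫ q, M.uhat q ∂(π : Measure (Belief X))) - M.κ * (1 / α) : ℝ) : EReal) := by
  have := isProbabilityMeasure_expNNReal hα
  have hmeas := hτ.1.measurable'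
  have hfin := ae_jumpPath hα hτ.2
  have hU : ∫ q, (M.uhat q - M.uhat q₀) ∂(π : Measure (Belief X)) =
      (∫ q, M.uhat q ∂(π : Measure (Belief X))) - M.uhat q₀ := by
    rw [integral_sub (M.integrable_uhat _) (integrable_const _)]
    simp
  have hdelay := lintegral_dilutionLaw (q₀ := q₀) (π := π) hα
    (f := fun ω => ((τ ω).untopA : ℝ≥0∞)) hmeas.untopA.coe_nnreal_ennreal
  -- By Galmarino's test, `τ` can stop before the jump only at the date it assigns to the constant
  -- path. If that is `⊤`, it always waits at least for the jump.
  cases hT : τ (constPath q₀) with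
  | top =>
    have hafter : ∀ᵐ p ∂((expNNReal α).prod (π : Measure (Belief X))),
        p.1 ≤ (τ (jumpPath q₀ p)).untopA := by
      filter_upwards [hfin] with p hp
      by_contra! hlt
      have := stoppingTime_constPath_eq hτ.1 (WithTop.coe_untop _ hp).symm
        (by rwa [WithTop.untopA_eq_untop hp] at hlt)
      rw [hT] at this
      exact WithTop.coe_ne_top this.symm
    refine (Environment.agentPayoff_le (one_div_pos.2 hα).le ?_).trans (EReal.coe_le_coe_iff.2 ?_)
    · rw [hdelay, ← lintegral_expNNReal hα, ← lintegral_prod_fst (π := π) hα (by fun_prop)]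
      exact lintegral_mono_ae (hafter.mono fun p hp => ENNReal.coe_le_coe.2 hp)
    · refine le_of_eq ?_
      congr 1
      have h1 := integral_fun_snd (μ := expNNReal α) (ν := (π : Measure (Belief X))) M.uhat
      simp only [probReal_univ, one_smul] at h1
      rw [← h1, M.integral_uhat_stoppedValue hα hmeas]
      refine integral_congr_ae (hafter.mono fun p hp => ?_)
      have : (stoppedValue belief τ (jumpPath q₀ p) : Belief X) = p.2 := belief_jumpPath_of_le hp
      simp only [this]
  -- Now `τ` stops at `t` if there is no jump by `t`, and otherwise not before the jump.
  | coe t =>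
    have hvalue : ∀ᵐ p ∂((expNNReal α).prod (π : Measure (Belief X))),
        min t p.1 ≤ (τ (jumpPath q₀ p)).untopA ∧
        M.uhat (stoppedValue belief τ (jumpPath q₀ p)) =
          (if p.1 ≤ t then M.uhat p.2 - M.uhat q₀ else 0) + M.uhat q₀ := by
      filter_upwards [hfin] with p hp
      split_ifs with hpt
      · have hle : p.1 ≤ (τ (jumpPath q₀ p)).untopA := by
          by_contra! hlt
          have := stoppingTime_constPath_eq hτ.1 (WithTop.coe_untop _ hp).symm
            (by rwa [WithTop.untopA_eq_untop hp] at hlt)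
          rw [hT, WithTop.coe_inj, ← WithTop.untopA_eq_untop hp] at this
          exact absurd (this ▸ hpt) (not_le.2 hlt)
        have hval : (stoppedValue belief τ (jumpPath q₀ p) : Belief X) = p.2 :=
          belief_jumpPath_of_le hle
        exact ⟨(min_le_right _ _).trans hle, by rw [hval, sub_add_cancel]⟩
      · have heq : (τ (jumpPath q₀ p)).untopA = t := by
          rw [stoppingTime_jumpPath_eq hτ.1 hT (not_le.1 hpt)]
          rfl
        have hval : (stoppedValue belief τ (jumpPath q₀ p) : Belief X) = q₀ :=
          belief_jumpPath_of_lt (heq ▸ not_le.1 hpt)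
        exact ⟨heq ▸ min_le_left _ _, by rw [hval, zero_add]⟩
    set c := (expNNReal α).real (Set.Iic t) with hc
    have hc1 : c ≤ 1 := measureReal_le_one
    have hpay : ∫ ω, M.uhat (stoppedValue belief τ ω) ∂(dilutionLaw q₀ π α) =
        c * (∫ q, (M.uhat q - M.uhat q₀) ∂(π : Measure (Belief X))) + M.uhat q₀ := by
      rw [M.integral_uhat_stoppedValue hα hmeas, integral_congr_ae (hvalue.mono fun p hp => hp.2),
        integral_add (integrable_ite_le hα (g := fun q => M.uhat q - M.uhat q₀)
          (integrable_of_continuous (M.continuous_uhat.sub continuous_const) _) t)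
          (integrable_const _), integral_ite_le hα (fun q => M.uhat q - M.uhat q₀)]
      simp [hc]
    refine (Environment.agentPayoff_le (d := c / α) (by positivity) ?_).trans
      (EReal.coe_le_coe_iff.2 ?_)
    · rw [hdelay, hc, ← lintegral_min_expNNReal hα,
        ← lintegral_prod_fst (π := π) hα (f := fun e => ((min t e : ℝ≥0) : ℝ≥0∞)) (by fun_prop)]
      exact lintegral_mono_ae (hvalue.mono fun p hp => ENNReal.coe_le_coe.2 hp.1)
    · rw [hpay, hU]
      rw [hU] at hworth
      -- With `c` the probability of a jump by `t`, waiting gains at least `(1 - c) * (E[uhat -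
      -- uhat(q₀)] - κ / α)`, which is nonnegative.
      have := mul_le_mul_of_nonneg_left (sub_nonneg.2 hworth) (sub_nonneg.2 hc1)
      have h2 : M.κ * (c / α) = c * (M.κ / α) := by ring
      have h3 : M.κ * (1 / α) = M.κ / α := by ring
      rw [h2, h3]
      nlinarith

/-- When the gain is `χ / α`, the relaxed constraint says exactly that the jump is worth its
expected delay cost `κ / α`. -/
theorem Environment.isFeasible_dilutionLaw (hα : 0 < α) (hgain : M.infoGain q₀ π = M.χ / α)
    (hπ : M.IsRelaxedFeasible q₀ π) (hne : ∀ᵐ q ∂(π : Measure (Belief X)), q ≠ q₀) :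
    M.IsFeasible q₀ (dilutionLaw q₀ π α) (fun t _ => M.χ * (t : ℝ)) firstJump := by
  refine ⟨M.isPolicy_dilutionLaw hα hgain hπ.1 hne, isAdmissibleTime_firstJump hα hne,
    fun τ' hτ' => (M.agentPayoff_dilutionLaw_le hα ?_ hτ').trans
      (M.le_agentPayoff_firstJump hα hne)⟩
  have h := hπ.2
  rw [hgain, div_mul_div_cancel₀ M.χ_pos.ne'] at h
  exact h

lemma Environment.engagement_dilutionLaw (hα : 0 < α) (hgain : M.infoGain q₀ π = M.χ / α)
    (hne : ∀ᵐ q ∂(π : Measure (Belief X)), q ≠ q₀) :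
    M.engagement (dilutionLaw q₀ π α) (fun t _ => M.χ * (t : ℝ)) firstJump =
      ENNReal.ofReal (M.ρ * M.infoGain q₀ π) := by
  have h : ∀ ω : PathSpace X, ENNReal.ofReal (stoppedValue
      (fun (t : ℝ≥0) (_ : PathSpace X) => M.χ * (t : ℝ)) firstJump ω) =
      ENNReal.ofReal M.χ * ((firstJump ω).untopA : ℝ≥0∞) := fun ω => by
    rw [stoppedValue, ENNReal.ofReal_mul M.χ_pos.le, ENNReal.ofReal_coe_nnreal]
  rw [Environment.engagement, lintegral_congr h, lintegral_const_mul' _ _ ENNReal.ofReal_ne_top,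
    lintegral_firstJump hα hne, ← ENNReal.ofReal_mul M.χ_pos.le, ← ENNReal.ofReal_mul M.ρ_pos.le,
    hgain, mul_one_div]

/-- Revealing nothing and stopping at once is feasible. -/
theorem Environment.isFeasible_constPath (M : Environment X A) (q₀ : Belief X) :
    M.IsFeasible q₀ (Measure.dirac (constPath q₀)) (fun _ _ => 0)
      (fun _ => ((0 : ℝ≥0) : WithTop ℝ≥0)) := by
  have hprior : ∀ t, ∀ᵐ ω ∂(Measure.dirac (constPath q₀)), belief t ω = q₀ := fun t => by
    have hset : MeasurableSet {ω : PathSpace X | belief t ω = q₀} :=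
      measurable_belief t (measurableSet_singleton q₀)
    exact (ae_dirac_iff hset).2 rfl
  have hsm : ∀ t, StronglyMeasurable[naturalFiltration X t]
      fun ω : PathSpace X => (belief t ω : X → ℝ) := fun t =>
    Continuous.comp_stronglyMeasurable (g := fun q : Belief X => (q : X → ℝ))
      continuous_subtype_val (stronglyMeasurable_belief le_rfl)
  refine ⟨⟨inferInstance, hprior 0, ⟨hsm, fun s t _ => ?_⟩, fun _ => measurable_const,
    Eventually.of_forall fun _ => rfl, Eventually.of_forall fun _ _ _ _ => le_rfl,
    isAdmissibleTime_const _ 0, fun s t _ => ?_, Eventually.of_forall fun _ s t hst _ => ?_⟩,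
    isAdmissibleTime_const _ 0, fun τ' hτ' => ?_⟩
  · have h1 : ∀ t, (fun ω => (belief t ω : X → ℝ)) =ᵐ[Measure.dirac (constPath q₀)]
        fun _ => (q₀ : X → ℝ) := fun t => (hprior t).mono fun ω hω => by simp only [hω]
    refine (condExp_congr_ae (h1 t)).trans ?_
    rw [condExp_const ((naturalFiltration X).le s)]
    exact (h1 s).symm
  · have hz : ∀ r : ℝ≥0,
        (min (r : WithTop ℝ≥0) ((0 : ℝ≥0) : WithTop ℝ≥0)).untopA = 0 := fun r => by
      rw [untopA_min_coe]
      exact min_eq_right zero_le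
    simp only [stoppedProcess, hz, sub_self]
    rfl
  · rw [sub_self]
    exact mul_nonneg M.χ_pos.le (sub_nonneg.2 (NNReal.coe_le_coe.2 hst))
  -- The belief never moves, so any stopping time yields `uhat q₀` less a nonnegative delay cost.
  · rw [Environment.agentPayoff_zero (hprior 0)]
    refine (Environment.agentPayoff_le le_rfl (by simp)).trans (EReal.coe_le_coe_iff.2 ?_)
    rw [integral_dirac' (f := fun ω => M.uhat (stoppedValue belief τ' ω))]
    · simp [stoppedValue, belief, constPath]
    · exact (M.continuous_uhat.measurable.comp
        (measurable_stoppedValue_belief hτ'.1.measurable')).stronglyMeasurable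

end Optimality

end Engagement

/-! ### The theorem, from the upper bound and its attainment. -/

theorem theorem1 {X A : Type*} [Fintype X] [Fintype A] [Nonempty A]
    (M : Engagement.Environment X A) (q₀ : Engagement.Belief X) :
    (∃ π : ProbabilityMeasure (Engagement.Belief X),
      M.IsRelaxedSolution q₀ π ∧ (π : Measure (Engagement.Belief X)).support.Finite) ∧
    ∀ π : ProbabilityMeasure (Engagement.Belief X),
      M.IsRelaxedSolution q₀ π → (π : Measure (Engagement.Belief X)).support.Finite →
      ((π : Measure (Engagement.Belief X)).support = {q₀} →
        (∃ P I τ, M.IsFeasible q₀ P I τ) ∧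
        ∀ P I τ, M.IsFeasible q₀ P I τ →
          (∀ᵐ ω ∂P, τ ω = 0) ∧ M.IsOptimal q₀ P I τ) ∧
      ((π : Measure (Engagement.Belief X)).support ≠ {q₀} →
        0 < M.infoGain q₀ π ∧
        ∃ τ : Engagement.PathSpace X → WithTop ℝ≥0,
          τ =ᵐ[Engagement.dilutionLaw q₀ π (M.χ / M.infoGain q₀ π)] Engagement.jumpTime ∧
          M.IsOptimal q₀ (Engagement.dilutionLaw q₀ π (M.χ / M.infoGain q₀ π))
            (fun t _ => M.χ * (t : ℝ)) τ) := by
  refine ⟨M.exists_relaxedSolution q₀, fun π hπ _ => ⟨fun hsupp => ?_, fun hsupp => ?_⟩⟩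
  · have h0 := M.infoGain_eq_zero_of_ae_eq (Engagement.support_eq_singleton_iff.1 hsupp)
    refine ⟨⟨_, _, _, M.isFeasible_constPath q₀⟩, fun P I τ h =>
      ⟨hπ.stops_at_once h0 h, h, fun P' I' τ' h' => (hπ.engagement_le h').trans ?_⟩⟩
    -- The upper bound on engagement is zero here, so every feasible policy attains it.
    simp [h0]
  · have hpos : 0 < M.infoGain q₀ π := by
      by_contra! hle
      exact hsupp (Engagement.support_eq_singleton_iff.2 (M.ae_eq_of_infoGain_nonpos hπ.1.1 hle))
    have hα : 0 < M.χ / M.infoGain q₀ π := div_pos M.χ_pos hpos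
    have hgain : M.infoGain q₀ π = M.χ / (M.χ / M.infoGain q₀ π) :=
      (div_div_cancel₀ M.χ_pos.ne').symm
    have hne := hπ.ae_ne hpos
    refine ⟨hpos, Engagement.firstJump, Engagement.firstJump_ae_eq_jumpTime hα hne,
      M.isFeasible_dilutionLaw hα hgain hπ.1 hne, fun P' I' τ' h' => ?_⟩
    rw [M.engagement_dilutionLaw hα hgain hne]
    exact hπ.engagement_le h'
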